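/- Let $d\ge 1$ be an integer, let $\|\cdot\|$ denote the max norm on $\mathbb R^d$, and for $a,A\in\mathbb R$ and positive integers $q,Q$ put $\Psi_{a,A}(q,Q)=q^{-a}Q^{-A}$. Given a function $\Psi$ of two positive integers with values in $(0,\infty)$, say that $\mathbb R^d$ is *uniformly $\Psi$-approximable* if there is a positive integer $Q_0$ such that for every $\mathbf x\in\mathbb R^d$ and every integer $Q\ge Q_0$ there exist $\mathbf p\in\mathbb Z^d$ and an integer $1\le q\le Q$ (with $\mathbf p/q$ not necessarily reduced) such that $$\left\|\mathbf x-\frac{\mathbf p}{q}\right\|<\Psi(q,Q).$$ Define $f_d:\mathbb R\to\mathbb R$ by $$f_d(a)=\begin{cases}1+|a| & a\le 0,\\ \left(\sum_{i=0}^{d-1}a^i\right)^{-1} & 0\le a\le 1,\\ 1+1/d-a & 1\le a\le 1+1/d,\\ 0 & a\ge 1+1/d\end{cases}$$ (with $0^0=1$; the formulas agree at the common endpoints). Fix $(a,A)\in\mathbb R^2$. (i) If $A<f_d(a)$, then for every $\epsilon>0$, $\mathbb R^d$ is uniformly $\epsilon\Psi_{a,A}$-approximable. (ii) If $A>f_d(a)$,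 then $\mathbb R^d$ is not uniformly $\kappa\Psi_{a,A}$-approximable for any $\kappa>0$. (iii) If $A=f_d(a)$, then there exist $0<\epsilon\le\kappa<\infty$ such that $\mathbb R^d$ is uniformly $\kappa\Psi_{a,A}$-approximable but not uniformly $\epsilon\Psi_{a,A}$-approximable. -/

import Mathlib

namespace DirichletVariations

/-- `x ∈ ℝ^d` is `(Ψ, Q₀)`-approximable: for every integer `Q ≥ Q₀` there are `p ∈ ℤ^d` and an
integer `1 ≤ q ≤ Q` with `‖x - p/q‖ < Ψ(q, Q)`. The norm on `Fin d → ℝ` is the max norm, and the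
fraction `p/q` need not be reduced. -/
def IsApproximableFrom {d : ℕ} (Ψ : ℕ → ℕ → ℝ) (Q₀ : ℕ) (x : Fin d → ℝ) : Prop :=
  ∀ Q : ℕ, Q₀ ≤ Q → ∃ (p : Fin d → ℤ) (q : ℕ), 1 ≤ q ∧ q ≤ Q ∧
    ‖x - fun i => (p i : ℝ) / (q : ℝ)‖ < Ψ q Q

/-- A set `S ⊆ ℝ^d` is uniformly `Ψ`-approximable: all its points are `(Ψ, Q₀)`-approximable for
one common positive integer `Q₀`. -/
def UniformlyApproximable {d : ℕ} (Ψ : ℕ → ℕ → ℝ) (S : Set (Fin d → ℝ)) : Prop :=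
  ∃ Q₀ : ℕ, 0 < Q₀ ∧ ∀ x ∈ S, IsApproximableFrom Ψ Q₀ x

/-- `Ψ_{a,A}(q, Q) = q^{-a} Q^{-A}`. -/
noncomputable def Psi (a A : ℝ) (q Q : ℕ) : ℝ :=
  (q : ℝ) ^ (-a) * (Q : ℝ) ^ (-A)

/-- The critical exponent `f_d(a)`. -/
noncomputable def fd (d : ℕ) (a : ℝ) : ℝ :=
  if a ≤ 0 then 1 + |a|
  else if a ≤ 1 then (∑ i ∈ Finset.range d, a ^ i)⁻¹
  else if a ≤ 1 + 1 / (d : ℝ) then 1 + 1 / (d : ℝ) - a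
  else 0

end DirichletVariations

open DirichletVariations

/-! Everything is decided at the critical exponent. Changing `A` by a positive amount multiplies `Ψ`
by a power of `Q` that outgrows every constant (`exists_mul_Psi_le`), so (i) and (ii) follow from
the two halves of (iii).

Failure (`exists_far_point`) needs, for each `Q`, one point far from all fractions of denominator at
most `Q`; the point may depend on `Q`. For `a ≤ 0` every coordinate is `1 / (2Q)`. For `0 < a ≤ 1`
coordinates `1 / (2T)` are stacked with a decreasing sequence of scales `T`. For `a > 1` a badly
approximable vector, made of powers of a root of 2, serves all `Q`.

Success (`exists_uniformlyApproximable`) is rounding with `q = Q` for `a ≤ 0` and with `q = 1` for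
`a > 1 + 1/d`; the range between `1` and `1 + 1/d` follows from `a = 1`. The core is `0 < a ≤ 1`: a
point of `ℤ^(d+1)` is sought within `s^(1-a) R` of `s • X`, where `X` spans the ray through `(1, y)`
and `1 ≤ s ≤ Q`. Either a tube of length `Q` and width about `Q^(1-a) R` has such a point in its far
half, or transference yields a short dual vector `m` nearly orthogonal to `X`. In the second case
the lattice is cut with `mᗮ` and `X` is projected there. The rank drops by one, the covolume grows
by at most `‖m‖`, and the tilt of the ray limits `s` through `s^a`. This turns a requirement with
exponent `F` into one with `1 + a F`, whence the sum of the `a^i` (`exists_lattice_point_near_ray`).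
-/

/-! ### Points far from fractions of bounded denominator -/

theorem sum_range_pow_succ (a : ℝ) (d : ℕ) :
    ∑ i ∈ Finset.range (d + 1), a ^ i = 1 + a * ∑ i ∈ Finset.range d, a ^ i := by
  rw [Finset.sum_range_succ', Finset.mul_sum, add_comm]
  simp [pow_succ, mul_comm]

theorem one_sub_mul_sum_range_pow_le {a : ℝ} (ha : 0 ≤ a) (d : ℕ) :
    (1 - a) * ∑ i ∈ Finset.range d, a ^ i ≤ 1 := by
  rw [mul_comm, geom_sum_mul_neg]
  linarith [pow_nonneg ha d]

/-- A point of `ℝ` close to `0` is far from every nonzero fraction of bounded denominator. -/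
theorem half_inv_le_abs_sub_div {T : ℝ} {q : ℕ} (hq : 1 ≤ q) (hqT : (q : ℝ) ≤ T) {p : ℤ}
    (hp : p ≠ 0) : 1 / (2 * (q : ℝ)) ≤ |1 / (2 * T) - (p : ℝ) / q| := by
  have hq0 : (0 : ℝ) < q := by exact_mod_cast hq
  have h1 : 1 / (2 * T) ≤ 1 / (2 * (q : ℝ)) := by gcongr
  have hT0 : 0 < T := hq0.trans_le hqT
  have h0 : 0 ≤ 1 / (2 * T) := by positivity
  have h2 : (1 : ℝ) / q = 1 / (2 * q) + 1 / (2 * q) := by field_simp; norm_num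
  rcases lt_or_gt_of_ne hp with h | h
  · have : (p : ℝ) ≤ -1 := by exact_mod_cast Int.le_sub_one_of_lt h
    have h3 : (p : ℝ) / q ≤ -1 / q := by gcongr
    have h4 : (-1 : ℝ) / q = - (1 / q) := by ring
    have h5 : 0 ≤ 1 / (2 * (q : ℝ)) := by positivity
    refine le_trans ?_ (le_abs_self _)
    linarith
  · have : (1 : ℝ) ≤ p := by exact_mod_cast h
    have h3 : 1 / (q : ℝ) ≤ p / q := by gcongr
    refine le_trans ?_ (neg_le_abs _)
    linarith

theorem half_inv_le_abs_sub_div' {T : ℝ} {q : ℕ} (hq : 1 ≤ q) (hqT : (q : ℝ) ≤ T) (p : ℤ) :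
    1 / (2 * T) ≤ |1 / (2 * T) - (p : ℝ) / q| := by
  have hq0 : (0 : ℝ) < q := by exact_mod_cast hq
  by_cases hp : p = 0
  · simpa only [hp, Int.cast_zero, zero_div, sub_zero] using le_abs_self _
  · refine le_trans ?_ (half_inv_le_abs_sub_div hq hqT hp)
    gcongr

/-- Prepend the coordinate `1 / (2T)` to a far point for a smaller scale. A nonzero first numerator
costs `1 / (2q)`, which suffices since `1 - a ≤ 1 / G`. If it is zero, small `q` are handled by the
old coordinates and large `q` by the distance `1 / (2T)` of the new one from `0`. -/
theorem exists_far_from_fractions {a : ℝ} (ha : 0 < a) (ha1 : a ≤ 1) (d : ℕ) {T : ℝ}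
    (hT : 1 ≤ T) : ∃ x : Fin (d + 1) → ℝ, ∀ (q : ℕ), 1 ≤ q → (q : ℝ) ≤ T → ∀ p : Fin (d + 1) → ℤ,
      1 / 2 * ((q : ℝ) ^ (-a) * T ^ (-(∑ i ∈ Finset.range (d + 1), a ^ i)⁻¹)) ≤
        ‖x - fun i => (p i : ℝ) / (q : ℝ)‖ := by
  induction d generalizing T with
  | zero =>
    refine ⟨fun _ => 1 / (2 * T), fun q hq hqT p => ?_⟩
    have hq1 : (1 : ℝ) ≤ q := by exact_mod_cast hq
    refine le_trans ?_ (norm_le_pi_norm _ 0)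
    rw [Pi.sub_apply, Real.norm_eq_abs]
    refine le_trans ?_ (half_inv_le_abs_sub_div' hq hqT (p 0))
    have h1 : (q : ℝ) ^ (-a) ≤ 1 := Real.rpow_le_one_of_one_le_of_nonpos hq1 (by linarith)
    have h2 : T ^ (-(∑ i ∈ Finset.range (0 + 1), a ^ i)⁻¹) = T⁻¹ := by
      simp [Real.rpow_neg_one]
    have hT0 : 0 < T⁻¹ := by positivity
    rw [h2]
    have h3 : 1 / (2 * T) = 1 / 2 * T⁻¹ := by field_simp
    rw [h3]
    nlinarith
  | succ d ih =>
    set F := ∑ i ∈ Finset.range (d + 1), a ^ i with hF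
    set G := ∑ i ∈ Finset.range (d + 1 + 1), a ^ i with hG
    have hGF : G = 1 + a * F := sum_range_pow_succ a (d + 1)
    have hF0 : 0 < F := by
      rw [hF]; exact Finset.sum_pos (fun i _ => pow_pos ha i) ⟨0, by simp⟩
    have hG1 : 1 ≤ G := by rw [hGF]; nlinarith
    have hG0 : 0 < G := by linarith
    have hT0 : 0 < T := by linarith
    -- The scale `T' = T^(F/G)` fits both regimes: `T'^(-1/F) = T^(-1/G)`, and at `q = T'` the
    -- target `q^(-a) T^(-1/G)` equals `1 / T` because `G = 1 + a F`.
    obtain ⟨x, hx⟩ := ih (T := T ^ (F / G)) (Real.one_le_rpow hT (by positivity))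
    refine ⟨Fin.cons (1 / (2 * T)) x, fun q hq hqT p => ?_⟩
    have hq1 : (1 : ℝ) ≤ q := by exact_mod_cast hq
    have hq0 : (0 : ℝ) < q := by linarith
    by_cases hp : p 0 = 0
    · rcases le_or_gt (q : ℝ) (T ^ (F / G)) with hqF | hqF
      · have := hx q hq hqF (fun i => p i.succ)
        rw [← Real.rpow_mul hT0.le] at this
        have he : F / G * -F⁻¹ = -G⁻¹ := by field_simp
        rw [he] at this
        refine this.trans ?_
        refine (pi_norm_le_iff_of_nonneg (norm_nonneg _)).2 fun i => ?_
        have := norm_le_pi_norm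
          ((Fin.cons (1 / (2 * T)) x : Fin (d + 1 + 1) → ℝ) - fun i => (p i : ℝ) / (q : ℝ)) i.succ
        simpa using this
      · refine le_trans ?_ (norm_le_pi_norm _ 0)
        rw [Pi.sub_apply, Real.norm_eq_abs, Fin.cons_zero]
        refine le_trans ?_ (half_inv_le_abs_sub_div' hq hqT (p 0))
        have h1 : (q : ℝ) ^ (-a) ≤ T ^ (F / G * -a) := by
          rw [Real.rpow_mul hT0.le]
          exact Real.rpow_le_rpow_of_nonpos (by positivity) hqF.le (by linarith)
        have h2 : T ^ (F / G * -a) * T ^ (-G⁻¹) = T⁻¹ := by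
          rw [← Real.rpow_add hT0, ← Real.rpow_neg_one T]
          have he : F / G * -a + -G⁻¹ = -1 := by
            field_simp
            linarith
          rw [he]
        have h3 : 1 / (2 * T) = 1 / 2 * T⁻¹ := by field_simp
        rw [h3, ← h2]
        gcongr
    · refine le_trans ?_ (norm_le_pi_norm _ 0)
      rw [Pi.sub_apply, Real.norm_eq_abs, Fin.cons_zero]
      refine le_trans ?_ (half_inv_le_abs_sub_div hq hqT hp)
      have h1 : T ^ (-G⁻¹) ≤ (q : ℝ) ^ (-(1 - a)) := by
        calc T ^ (-G⁻¹) ≤ T ^ (-(1 - a)) := by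
              apply Real.rpow_le_rpow_of_exponent_le hT
              have := one_sub_mul_sum_range_pow_le ha.le (d + 1 + 1)
              rw [← hG] at this
              have h5 : 1 - a ≤ G⁻¹ := by rw [← one_div, le_div_iff₀ hG0]; exact this
              linarith
          _ ≤ (q : ℝ) ^ (-(1 - a)) :=
              Real.rpow_le_rpow_of_nonpos hq0 hqT (by linarith)
      have h2 : (q : ℝ) ^ (-a) * (q : ℝ) ^ (-(1 - a)) = (q : ℝ)⁻¹ := by
        rw [← Real.rpow_add hq0, ← Real.rpow_neg_one]
        congr 1
        ring
      have h3 : 1 / (2 * (q : ℝ)) = 1 / 2 * (q : ℝ)⁻¹ := by field_simp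
      rw [h3, ← h2]
      gcongr

/-! ### Badly approximable vectors from powers of a root of 2 -/

open Polynomial in
theorem irreducible_X_pow_sub_two {n : ℕ} (hn : n ≠ 0) : Irreducible (X ^ n - C 2 : ℚ[X]) := by
  have hmon : (X ^ n - C 2 : ℤ[X]).Monic := monic_X_pow_sub_C 2 hn
  have hdeg : (X ^ n - C 2 : ℤ[X]).natDegree = n := natDegree_X_pow_sub_C
  have hmem : ∀ z : ℤ, z ∈ Ideal.span {(2 : ℤ)} ↔ 2 ∣ z := fun z => Ideal.mem_span_singleton
  have hprime : (Ideal.span {(2 : ℤ)}).IsPrime :=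
    (Ideal.span_singleton_prime two_ne_zero).2 Int.prime_two
  have heis : (X ^ n - C 2 : ℤ[X]).IsEisensteinAt (Ideal.span {(2 : ℤ)}) := by
    refine ⟨?_, ?_, ?_⟩
    · rw [hmon.leadingCoeff, hmem]
      norm_num
    · intro k hk
      rw [hdeg] at hk
      rw [hmem, coeff_sub, coeff_X_pow, if_neg hk.ne, coeff_C]
      split_ifs <;> norm_num
    · rw [Ideal.span_singleton_pow, Ideal.mem_span_singleton, coeff_sub, coeff_X_pow,
        if_neg (Ne.symm hn), coeff_C_zero]
      norm_num
  have h := heis.irreducible hprime hmon.isPrimitive (by rw [hdeg]; omega)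
  have h2 := (IsPrimitive.Int.irreducible_iff_irreducible_map_cast hmon.isPrimitive).1 h
  rwa [Polynomial.map_sub, Polynomial.map_pow, map_X, map_C, eq_intCast, Int.cast_ofNat] at h2

/-- The conjugates of `2q + ∑ pᵢ θ^(d-i)`, where `θ^(d+1) = 2`, in terms of the differences
`pᵢ - q α^(i+1)` for another root `α` of the same equation. -/
theorem conjugate_eq {d : ℕ} {y α : ℂ} (hy : y ^ (d + 1) = 2) (q : ℂ)
    (p : Fin d → ℂ) : 2 * q + ∑ i, p i * y ^ (d - (i : ℕ)) =
      2 * (∑ i, (p i - q * α ^ ((i : ℕ) + 1)) * (y⁻¹) ^ ((i : ℕ) + 1)) +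
        2 * q * ∑ j ∈ Finset.range (d + 1), (α / y) ^ j := by
  have hy0 : y ≠ 0 := by rintro rfl; simp at hy
  have h1 : ∀ i : Fin d, y ^ (d - (i : ℕ)) = 2 * (y⁻¹) ^ ((i : ℕ) + 1) := fun i => by
    rw [inv_pow, ← div_eq_mul_inv, eq_div_iff (pow_ne_zero _ hy0), ← pow_add, ← hy]
    congr 1
    have := i.2
    omega
  rw [Finset.sum_range_succ', ← Fin.sum_univ_eq_sum_range (fun j => (α / y) ^ (j + 1))]
  simp only [h1, sub_mul, Finset.sum_sub_distrib, mul_add, pow_zero, mul_one, div_eq_mul_inv,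
    mul_pow, mul_assoc, mul_sub, ← Finset.mul_sum, mul_left_comm _ (2 : ℂ)]
  ring

-- The norm of `2q + ∑ pᵢ θ^(d-i)` is a nonzero integer, hence at least 1 in absolute value. In
-- `conjugate_eq` the geometric sum vanishes unless the conjugate of `θ` is `α` itself, so `d`
-- conjugates are at most `2 d ε` and the remaining one is of order `q`.
open Polynomial in
theorem one_le_of_approximates_roots_of_two {d : ℕ} {α : ℝ} (hα : 1 ≤ α)
    (hα2 : α ^ (d + 1) = 2) {q : ℕ} (hq : 1 ≤ q) (p : Fin d → ℤ) {ε : ℝ}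
    (hε : ∀ i, |(p i : ℝ) - q * α ^ ((i : ℕ) + 1)| ≤ ε) (hε0 : 0 ≤ ε) :
    1 ≤ 2 * ((d + 1) * q + d * ε) * (2 * d * ε) ^ d := by
  classical
  have hirr := irreducible_X_pow_sub_two (n := d + 1) (by omega)
  set f : ℚ[X] := X ^ (d + 1) - C 2 with hf
  have : Fact (Irreducible f) := ⟨hirr⟩
  have hf0 : f ≠ 0 := hirr.ne_zero
  have hdeg : f.natDegree = d + 1 := natDegree_X_pow_sub_C
  set θ := AdjoinRoot.root f with hθ
  have hθ2 : θ ^ (d + 1) = 2 := by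
    have := AdjoinRoot.eval₂_root f
    rw [hf] at this
    simp only [eval₂_sub, eval₂_X_pow, eval₂_C] at this
    have h2 := sub_eq_zero.1 this
    simpa using h2
  have : FiniteDimensional ℚ (AdjoinRoot f) := (AdjoinRoot.powerBasis hf0).finite
  -- Its degree is at most `d` and its constant term `2q` is nonzero, so `f` cannot divide it.
  set P : ℚ[X] := C (2 * (q : ℚ)) + ∑ i : Fin d, C (p i : ℚ) * X ^ (d - (i : ℕ)) with hP
  have hP0 : P.coeff 0 = 2 * q := by
    rw [hP, coeff_add, coeff_C_zero, finsetSum_coeff, Finset.sum_eq_zero, add_zero]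
    intro i _
    rw [coeff_C_mul, coeff_X_pow, if_neg, mul_zero]
    have := i.2
    omega
  have hPdeg : P.natDegree < d + 1 := by
    refine Nat.lt_succ_of_le (natDegree_add_le_of_degree_le (by rw [natDegree_C]; omega) ?_)
    refine natDegree_sum_le_of_forall_le _ _ fun i _ => ?_
    exact (natDegree_C_mul_X_pow_le _ _).trans (Nat.sub_le _ _)
  have hPne : P ≠ 0 := by
    intro h
    rw [h, coeff_zero] at hP0
    have : (q : ℚ) ≠ 0 := by positivity
    exact this (by linarith)
  set ξ : AdjoinRoot f := AdjoinRoot.mk f P with hξ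
  have hξ0 : ξ ≠ 0 := by
    rw [hξ, Ne, AdjoinRoot.mk_eq_zero]
    intro h
    have := natDegree_le_of_dvd h hPne
    omega
  have hξe : ξ = 2 * q + ∑ i : Fin d, (p i : AdjoinRoot f) * θ ^ (d - (i : ℕ)) := by
    simp [hξ, hP, hθ]
  have hint : IsIntegral ℤ ξ := by
    have hθi : IsIntegral ℤ θ := by
      refine IsIntegral.of_pow (n := d + 1) (by omega) ?_
      rw [hθ2]
      exact_mod_cast isIntegral_algebraMap (R := ℤ) (A := AdjoinRoot f) (x := 2)
    rw [hξe]
    refine IsIntegral.add ?_ (IsIntegral.sum _ fun i _ => ?_)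
    · exact_mod_cast isIntegral_algebraMap (R := ℤ) (A := AdjoinRoot f) (x := 2 * q)
    · exact (isIntegral_algebraMap (R := ℤ) (A := AdjoinRoot f) (x := p i)).mul (hθi.pow _)
  obtain ⟨N, hN⟩ := IsIntegrallyClosed.isIntegral_iff.1 (Algebra.isIntegral_norm ℚ hint)
  have hN0 : N ≠ 0 := by
    rintro rfl
    rw [map_zero] at hN
    exact hξ0 (Algebra.norm_eq_zero_iff.1 hN.symm)
  have hprod := Algebra.norm_eq_prod_embeddings ℚ ℂ ξ
  have hN1 : (1 : ℝ) ≤ ‖∏ σ : AdjoinRoot f →ₐ[ℚ] ℂ, σ ξ‖ := by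
    rw [← hprod, ← hN]
    have : (1 : ℤ) ≤ |N| := Int.one_le_abs hN0
    have h2 : (1 : ℝ) ≤ |(N : ℝ)| := by exact_mod_cast this
    simpa using h2
  rw [norm_prod] at hN1
  have hσ : ∀ σ : AdjoinRoot f →ₐ[ℚ] ℂ, (σ θ) ^ (d + 1) = 2 := fun σ => by
    rw [← map_pow, hθ2, map_ofNat]
  have hα0 : α ≠ 0 := by positivity
  have hnorm : ∀ σ : AdjoinRoot f →ₐ[ℚ] ℂ, ‖σ θ‖ = α := fun σ => by
    have h := congrArg norm (hσ σ)
    rw [norm_pow, Complex.norm_ofNat, ← hα2] at h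
    exact (pow_left_inj₀ (norm_nonneg _) (by positivity) (by omega)).1 h
  have hsum : ∀ σ : AdjoinRoot f →ₐ[ℚ] ℂ,
      ‖∑ i : Fin d, ((p i : ℂ) - q * (α : ℂ) ^ ((i : ℕ) + 1)) * ((σ θ)⁻¹) ^ ((i : ℕ) + 1)‖ ≤
        d * ε := fun σ => by
    refine (norm_sum_le _ _).trans ?_
    refine (Finset.sum_le_card_nsmul _ _ ε fun i _ => ?_).trans (by simp)
    rw [norm_mul, norm_pow, norm_inv, hnorm]
    have h1 : ‖(p i : ℂ) - q * (α : ℂ) ^ ((i : ℕ) + 1)‖ ≤ ε := by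
      have := hε i
      rw [← Real.norm_eq_abs, ← Complex.norm_real] at this
      simpa using this
    have h2 : α⁻¹ ^ ((i : ℕ) + 1) ≤ 1 := pow_le_one₀ (by positivity) (inv_le_one_of_one_le₀ hα)
    nlinarith [norm_nonneg ((p i : ℂ) - q * (α : ℂ) ^ ((i : ℕ) + 1))]
  have hσξ : ∀ σ : AdjoinRoot f →ₐ[ℚ] ℂ, σ ξ = _ := fun σ => by
    have h : σ ξ = 2 * (q : ℂ) + ∑ i : Fin d, (p i : ℂ) * σ θ ^ (d - (i : ℕ)) := by
      rw [hξe, map_add, map_mul, map_ofNat, map_natCast, map_sum]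
      simp
    exact h.trans (conjugate_eq (α := (α : ℂ)) (hσ σ) (q : ℂ) (fun i => (p i : ℂ)))
  have hsmall : ∀ σ : AdjoinRoot f →ₐ[ℚ] ℂ, σ θ ≠ α → ‖σ ξ‖ ≤ 2 * d * ε := fun σ hne => by
    have hσ0 : σ θ ≠ 0 := by
      intro h
      have := hnorm σ
      rw [h, norm_zero] at this
      exact hα0 this.symm
    have hgeo : ∑ j ∈ Finset.range (d + 1), ((α : ℂ) / σ θ) ^ j = 0 := by
      have h1 : (α : ℂ) / σ θ ≠ 1 := fun h => hne ((div_eq_one_iff_eq hσ0).1 h).symm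
      have h2 : ((α : ℂ) / σ θ) ^ (d + 1) = 1 := by
        rw [div_pow, hσ, ← Complex.ofReal_pow, hα2]
        norm_num
      rw [geom_sum_eq h1, h2, sub_self, zero_div]
    rw [hσξ, hgeo, mul_zero, add_zero, norm_mul, Complex.norm_ofNat]
    linarith [hsum σ]
  have hlarge : ∀ σ : AdjoinRoot f →ₐ[ℚ] ℂ, ‖σ ξ‖ ≤ 2 * ((d + 1) * q + d * ε) := fun σ => by
    rw [hσξ]
    refine (norm_add_le _ _).trans ?_
    have h1 : ‖∑ j ∈ Finset.range (d + 1), ((α : ℂ) / σ θ) ^ j‖ ≤ d + 1 := by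
      refine (norm_sum_le _ _).trans ?_
      refine (Finset.sum_le_card_nsmul _ _ 1 fun i _ => ?_).trans (by simp)
      rw [norm_pow, norm_div, hnorm, Complex.norm_real, Real.norm_of_nonneg (by linarith),
        div_self hα0, one_pow]
    rw [norm_mul, norm_mul, norm_mul, Complex.norm_ofNat, Complex.norm_natCast]
    have := hsum σ
    nlinarith [norm_nonneg (∑ j ∈ Finset.range (d + 1), ((α : ℂ) / σ θ) ^ j), hq,
      (Nat.cast_nonneg q : (0 : ℝ) ≤ q)]
  have hroot : f.eval₂ (algebraMap ℚ ℂ) (α : ℂ) = 0 := by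
    rw [hf]
    simp only [eval₂_sub, eval₂_X_pow, eval₂_C]
    rw [← Complex.ofReal_pow, hα2]
    simp
  let σ₀ : AdjoinRoot f →ₐ[ℚ] ℂ := AdjoinRoot.liftAlgHom f (Algebra.ofId ℚ ℂ) (α : ℂ) hroot
  have hσ₀ : σ₀ θ = α := AdjoinRoot.liftAlgHom_root ..
  have hinj : ∀ σ : AdjoinRoot f →ₐ[ℚ] ℂ, σ ≠ σ₀ → σ θ ≠ α := fun σ hne h =>
    hne (AdjoinRoot.algHom_ext (h.trans hσ₀.symm))
  have hcard : Fintype.card (AdjoinRoot f →ₐ[ℚ] ℂ) = d + 1 := by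
    rw [AlgHom.card, (AdjoinRoot.powerBasis hf0).finrank, AdjoinRoot.powerBasis_dim, hdeg]
  rw [← Finset.mul_prod_erase _ _ (Finset.mem_univ σ₀)] at hN1
  refine hN1.trans (mul_le_mul (hlarge σ₀) ?_ (Finset.prod_nonneg fun _ _ => norm_nonneg _)
    (by positivity))
  refine (Finset.prod_le_prod (fun _ _ => norm_nonneg _) fun σ h =>
    hsmall σ (hinj σ (Finset.ne_of_mem_erase h))).trans ?_
  rw [Finset.prod_const, Finset.card_erase_of_mem (Finset.mem_univ _), Finset.card_univ, hcard]
  simp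

/-- Badly approximable vectors exist. -/
theorem exists_badly_approximable {d : ℕ} (hd : 0 < d) : ∃ (c : ℝ) (x : Fin d → ℝ), 0 < c ∧
    ∀ (q : ℕ), 1 ≤ q → ∀ p : Fin d → ℤ,
      c * (q : ℝ) ^ (-(1 + 1 / (d : ℝ))) ≤ ‖x - fun i => (p i : ℝ) / (q : ℝ)‖ := by
  set α : ℝ := 2 ^ (((d + 1 : ℕ) : ℝ)⁻¹) with hα
  have hα1 : 1 ≤ α := Real.one_le_rpow (by norm_num) (by positivity)
  have hα2 : α ^ (d + 1) = 2 := Real.rpow_inv_natCast_pow (by norm_num) (by omega)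
  -- With `ε = c q^(-1/d)` the powers of `q` in the norm bound cancel, leaving at most `B c`; `c = 1
  -- / (2B)` makes this `1/2 < 1`.
  set B : ℝ := 4 * (d + 1) * (2 * d) ^ d with hB
  have hd1 : (1 : ℝ) ≤ d := by exact_mod_cast hd
  have hB1 : 1 ≤ B := by
    have : (1 : ℝ) ≤ (2 * d) ^ d := one_le_pow₀ (by linarith)
    rw [hB]
    nlinarith
  have hB0 : 0 < B := by linarith
  refine ⟨(2 * B)⁻¹, fun i => α ^ ((i : ℕ) + 1), by positivity, fun q hq p => ?_⟩
  by_contra! hlt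
  have hq1 : (1 : ℝ) ≤ q := by exact_mod_cast hq
  have hq0 : (0 : ℝ) < q := by linarith
  set c : ℝ := (2 * B)⁻¹ with hc
  have hc0 : 0 < c := by positivity
  have hc1 : c ≤ 1 := inv_le_one_of_one_le₀ (by linarith)
  set ε : ℝ := c * (q : ℝ) ^ (-(1 / (d : ℝ))) with hε
  have hε0 : 0 < ε := by positivity
  have hε1 : ε ≤ 1 := by
    have : (q : ℝ) ^ (-(1 / (d : ℝ))) ≤ 1 :=
      Real.rpow_le_one_of_one_le_of_nonpos hq1 (by simp)
    have h0 : 0 ≤ (q : ℝ) ^ (-(1 / (d : ℝ))) := by positivity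
    rw [hε]
    nlinarith
  have hεd : ε ^ d = c ^ d * (q : ℝ)⁻¹ := by
    rw [hε, mul_pow, ← Real.rpow_natCast ((q : ℝ) ^ _), ← Real.rpow_mul hq0.le,
      ← Real.rpow_neg_one (q : ℝ)]
    congr 2
    field_simp
  have hqε : (q : ℝ) * (c * (q : ℝ) ^ (-(1 + 1 / (d : ℝ)))) = ε := by
    rw [hε, neg_add, Real.rpow_add hq0, Real.rpow_neg_one]
    field_simp
  have hkey := one_le_of_approximates_roots_of_two hα1 hα2 hq p (ε := ε) (fun i => by
    have h1 := ((norm_le_pi_norm _ i).trans_lt hlt).le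
    rw [Pi.sub_apply, Real.norm_eq_abs] at h1
    have h2 : (p i : ℝ) - q * α ^ ((i : ℕ) + 1) = -(q * (α ^ ((i : ℕ) + 1) - p i / q)) := by
      field_simp
      ring
    rw [h2, abs_neg, abs_mul, abs_of_pos hq0, ← hqε]
    gcongr) hε0.le
  have h3 : 2 * ((d + 1) * q + d * ε) * (2 * d * ε) ^ d ≤ B * c := by
    have h4 : 2 * ((d + 1) * q + d * ε) ≤ 4 * (d + 1) * q := by nlinarith
    have h5 : c ^ d ≤ c := pow_le_of_le_one hc0.le hc1 hd.ne'
    calc 2 * ((d + 1) * q + d * ε) * (2 * d * ε) ^ d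
        ≤ 4 * (d + 1) * q * ((2 * d) ^ d * (c * (q : ℝ)⁻¹)) := by
          rw [mul_pow _ ε, hεd]
          gcongr
      _ = B * c := by rw [hB]; field_simp
  have h6 : B * c = 1 / 2 := by rw [hc]; field_simp
  linarith

/-! ### Gram determinants and sections of lattices -/

section Lattice

open Module Matrix

variable {E : Type*} [NormedAddCommGroup E] [InnerProductSpace ℝ E]

theorem gram_linearCombination {ι κ : Type*} [Fintype ι] (U : Matrix κ ι ℝ) (v : ι → E) :
    gram ℝ (fun k => ∑ i, U k i • v i) = U * gram ℝ v * Uᵀ := by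
  ext k l
  simp only [gram_apply, mul_apply, transpose_apply, sum_inner, inner_sum, real_inner_smul_left,
    real_inner_smul_right, Finset.sum_mul]
  refine Finset.sum_congr rfl fun i _ => Finset.sum_congr rfl fun j _ => ?_
  ring

theorem det_gram_linearCombination {ι : Type*} [Fintype ι] [DecidableEq ι] (U : Matrix ι ι ℝ)
    (v : ι → E) :
    (gram ℝ (fun k => ∑ i, U k i • v i)).det = U.det ^ 2 * (gram ℝ v).det := by
  rw [gram_linearCombination, det_mul, det_mul, det_transpose]
  ring

theorem det_gram_cons_of_orthogonal {n : ℕ} (w : E) (v : Fin n → E)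
    (h : ∀ i, inner ℝ (v i) w = 0) :
    (gram ℝ (Fin.cons w v : Fin (n + 1) → E)).det = ‖w‖ ^ 2 * (gram ℝ v).det := by
  rw [det_succ_column_zero, Finset.sum_eq_single 0]
  · simp only [gram_apply, Fin.cons_zero, real_inner_self_eq_norm_sq]
    have : (gram ℝ (Fin.cons w v : Fin (n + 1) → E)).submatrix (Fin.succAbove 0) Fin.succ =
        gram ℝ v := by
      ext i j
      simp [gram_apply]
    rw [this]
    simp
  · intro i _ hi
    obtain ⟨j, rfl⟩ := Fin.exists_succ_eq.2 hi
    simp [gram_apply, h j]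
  · simp

theorem det_gram_cons_add {n : ℕ} (w : E) (v : Fin n → E) (r : Fin n → ℝ) :
    (gram ℝ (Fin.cons (w + ∑ i, r i • v i) v : Fin (n + 1) → E)).det =
      (gram ℝ (Fin.cons w v : Fin (n + 1) → E)).det := by
  set V : Matrix (Fin (n + 1)) (Fin (n + 1)) ℝ :=
    of (Fin.cons (Fin.cons 1 r) fun i => Fin.cons 0 (Pi.single i 1)) with hV
  have h1 : (Fin.cons (w + ∑ i, r i • v i) v : Fin (n + 1) → E) =
      fun k => ∑ i, V k i • (Fin.cons w v : Fin (n + 1) → E) i := by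
    ext k
    refine Fin.cases ?_ (fun k => ?_) k
    · simp [hV, Fin.sum_univ_succ]
    · simp [hV, Fin.sum_univ_succ, Pi.single_apply]
  have h2 : V.det = 1 := by
    rw [det_succ_column_zero, Finset.sum_eq_single 0]
    · have : V.submatrix (Fin.succAbove 0) Fin.succ = 1 := by
        ext i j
        simp [hV, one_apply, Pi.single_apply, eq_comm]
      rw [this]
      simp [hV]
    · intro i _ hi
      obtain ⟨j, rfl⟩ := Fin.exists_succ_eq.2 hi
      simp [hV]
    · simp
  rw [h1, det_gram_linearCombination, h2, one_pow, one_mul]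

theorem exists_int_inner_of_mem_span {ι : Type*} {b : ι → E} {m : E}
    (hm : ∀ i, ∃ z : ℤ, inner ℝ m (b i) = z) {v : E} (hv : v ∈ Submodule.span ℤ (Set.range b)) :
    ∃ z : ℤ, inner ℝ m v = z := by
  induction hv using Submodule.span_induction with
  | mem x hx => obtain ⟨i, rfl⟩ := hx; exact hm i
  | zero => exact ⟨0, by simp⟩
  | add x y _ _ hx hy =>
    obtain ⟨s, hs⟩ := hx
    obtain ⟨t, ht⟩ := hy
    exact ⟨s + t, by rw [inner_add_right, hs, ht, Int.cast_add]⟩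
  | smul c x _ hx =>
    obtain ⟨s, hs⟩ := hx
    exact ⟨c * s, by rw [← Int.cast_smul_eq_zsmul ℝ, real_inner_smul_right, hs, Int.cast_mul]⟩

/-- A primitive dual vector `m` of a lattice cuts out a sublattice of its orthogonal complement,
of covolume at most `‖m‖` times that of the lattice. -/
theorem exists_basis_orthogonal {n : ℕ} (b : Basis (Fin (n + 1)) ℝ E) {m w : E}
    (hm : ∀ i, ∃ z : ℤ, inner ℝ m (b i) = z) (hw : w ∈ Submodule.span ℤ (Set.range b))
    (hmw : inner ℝ m w = 1) :
    ∃ c : Basis (Fin n) ℝ (ℝ ∙ m)ᗮ, (∀ i, (c i : E) ∈ Submodule.span ℤ (Set.range b)) ∧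
      (∀ u ∈ Submodule.span ℤ (Set.range b), inner ℝ m u = 0 →
        ∃ k : Fin n → ℤ, u = ∑ j, k j • (c j : E)) ∧
      (gram ℝ c).det ≤ (gram ℝ b).det * ‖m‖ ^ 2 := by
  have hm0 : m ≠ 0 := by
    rintro rfl
    simp at hmw
  choose z hz using hm
  set Γ := Submodule.span ℤ (Set.range b) with hΓ
  have hbΓ : ∀ i, b i ∈ Γ := fun i => Submodule.subset_span ⟨i, rfl⟩
  let bz : Basis (Fin (n + 1)) ℤ Γ := b.restrictScalars ℤ
  let φ : Γ →ₗ[ℤ] ℤ := bz.constr ℤ z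
  have hφ : ∀ v : Γ, ((φ v : ℤ) : ℝ) = inner ℝ m (v : E) := fun v => by
    have h1 : φ v = ∑ i, bz.repr v i * z i := by
      simp [φ, Basis.constr_apply_fintype]
    have h2 : (v : E) = ∑ i, (bz.repr v i : ℝ) • b i := by
      conv_lhs => rw [← b.sum_repr v]
      refine Finset.sum_congr rfl fun i _ => ?_
      rw [← Basis.restrictScalars_repr_apply ℤ b v i]
      rfl
    rw [h1, h2, inner_sum]
    simp [real_inner_smul_right, hz]
  have hφs : Function.Surjective φ := fun t => by
    refine ⟨t • ⟨w, hw⟩, ?_⟩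
    have h1 : φ ⟨w, hw⟩ = 1 := by
      have := hφ ⟨w, hw⟩
      rw [hmw] at this
      exact_mod_cast this
    rw [map_smul, h1]
    simp
  have : Module.Finite ℤ Γ := Module.Finite.of_basis bz
  have : Module.Free ℤ Γ := Module.Free.of_basis bz
  have hrank : finrank ℤ (LinearMap.ker φ) = n := by
    have h1 := (LinearMap.ker φ).finrank_quotient_add_finrank
    rw [(φ.quotKerEquivOfSurjective hφs).finrank_eq, finrank_self, finrank_eq_card_basis bz,
      Fintype.card_fin] at h1
    omega
  let k₀ := finBasisOfFinrankEq ℤ (LinearMap.ker φ) hrank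
  have hperp : ∀ v : LinearMap.ker φ, ((v : Γ) : E) ∈ (ℝ ∙ m)ᗮ := fun v => by
    rw [Submodule.mem_orthogonal_singleton_iff_inner_right, ← hφ, LinearMap.mem_ker.1 v.2,
      Int.cast_zero]
  let c₀ : Fin n → (ℝ ∙ m)ᗮ := fun i => ⟨((k₀ i : Γ) : E), hperp _⟩
  have hcomb : ∀ u ∈ Γ, inner ℝ m u = 0 → ∃ k : Fin n → ℤ, u = ∑ j, k j • (c₀ j : E) := by
    intro u hu hmu
    have hker : (⟨u, hu⟩ : Γ) ∈ LinearMap.ker φ := by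
      have := hφ ⟨u, hu⟩
      rw [hmu] at this
      rw [LinearMap.mem_ker]
      exact_mod_cast this
    refine ⟨fun j => k₀.repr ⟨⟨u, hu⟩, hker⟩ j, ?_⟩
    have h1 := congrArg (fun v : LinearMap.ker φ => ((v : Γ) : E)) (k₀.sum_repr ⟨⟨u, hu⟩, hker⟩)
    simp only [Submodule.coe_sum, Submodule.coe_smul] at h1
    exact h1.symm
  have hbw : ∀ i, ∃ k : Fin n → ℤ, b i - z i • w = ∑ j, k j • (c₀ j : E) := fun i => by
    refine hcomb _ (sub_mem (hbΓ i) (Submodule.smul_mem _ _ hw)) ?_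
    rw [inner_sub_right, ← Int.cast_smul_eq_zsmul ℝ, real_inner_smul_right, hmw, hz]
    ring
  choose k hk using hbw
  have hspan : ⊤ ≤ Submodule.span ℝ (Set.range c₀) := by
    rintro ⟨v, hv⟩ -
    rw [Submodule.mem_orthogonal_singleton_iff_inner_right] at hv
    have h1 : (⟨v, Submodule.mem_orthogonal_singleton_iff_inner_right.2 hv⟩ : (ℝ ∙ m)ᗮ) =
        ∑ i, b.repr v i • ∑ j, (k i j : ℝ) • c₀ j := by
      apply Subtype.ext
      simp only [Submodule.coe_sum, Submodule.coe_smul]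
      simp only [Int.cast_smul_eq_zsmul, ← hk, smul_sub, Finset.sum_sub_distrib, b.sum_repr]
      have h2 : ∑ i, b.repr v i • z i • w = (inner ℝ m v : ℝ) • w := by
        conv_rhs => rw [← b.sum_repr v, inner_sum, Finset.sum_smul]
        refine Finset.sum_congr rfl fun i _ => ?_
        rw [real_inner_smul_right, hz, mul_smul, Int.cast_smul_eq_zsmul]
      rw [h2, hv, zero_smul, sub_zero]
    rw [h1]
    exact Submodule.sum_mem _ fun i _ => Submodule.smul_mem _ _ <|
      Submodule.sum_mem _ fun j _ => Submodule.smul_mem _ _ (Submodule.subset_span ⟨j, rfl⟩)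
  have : FiniteDimensional ℝ E := Module.Finite.of_basis b
  have hfin : finrank ℝ E = n + 1 := by simp [finrank_eq_card_basis b]
  have : Fact (finrank ℝ E = n + 1) := ⟨hfin⟩
  let c : Basis (Fin n) ℝ (ℝ ∙ m)ᗮ := basisOfTopLeSpanOfCardEqFinrank c₀ hspan
    ((Fintype.card_fin n).trans (Submodule.finrank_orthogonal_span_singleton hm0).symm)
  have hc : ⇑c = c₀ := coe_basisOfTopLeSpanOfCardEqFinrank _ _ _
  refine ⟨c, fun i => ?_, ?_, ?_⟩
  · rw [hc]
    exact (k₀ i : Γ).2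
  · rw [hc]
    exact hcomb
  set d : Fin (n + 1) → E := Fin.cons w (fun i => (c i : E)) with hd
  let U : Matrix (Fin (n + 1)) (Fin (n + 1)) ℤ := of fun i => Fin.cons (z i) (k i)
  have hbU : (b : Fin (n + 1) → E) = fun i => ∑ j, (U.map (Int.cast : ℤ → ℝ)) i j • d j := by
    ext i
    have := hk i
    rw [sub_eq_iff_eq_add] at this
    rw [this, Fin.sum_univ_succ]
    simp [U, hd, hc, Int.cast_smul_eq_zsmul, add_comm]
  have hb0 : 0 < (gram ℝ b).det := (posDef_gram_of_linearIndependent b.linearIndependent).det_pos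
  -- The integer matrix `U` is invertible over `ℝ`, so `det U ^ 2 ≥ 1`; this inequality is all that
  -- is needed.
  have hdb : (gram ℝ d).det ≤ (gram ℝ b).det := by
    have h1 : (U.map (Int.cast : ℤ → ℝ)).det = (U.det : ℝ) := by
      have := (Int.castRingHom ℝ).map_det U
      simpa using this.symm
    rw [hbU, det_gram_linearCombination, h1] at hb0 ⊢
    have h0 : 0 ≤ (gram ℝ d).det := (posSemidef_gram ℝ d).det_nonneg
    have hU : U.det ≠ 0 := by
      intro h
      rw [h] at hb0
      simp at hb0
    have h2 : (1 : ℝ) ≤ (U.det : ℝ) ^ 2 := by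
      have : 0 < U.det ^ 2 := by positivity
      exact_mod_cast this
    nlinarith
  have hmm : 0 < ‖m‖ ^ 2 := by positivity
  -- The component of `w` along `m`; the rest of `w` lies in the span of `c` and does not affect the
  -- Gram determinant.
  set u : E := (‖m‖ ^ 2)⁻¹ • m with hu
  have hwu : w - u ∈ (ℝ ∙ m)ᗮ := by
    rw [Submodule.mem_orthogonal_singleton_iff_inner_right, inner_sub_right, hmw, hu,
      real_inner_smul_right, real_inner_self_eq_norm_sq, inv_mul_cancel₀ hmm.ne', sub_self]
  have hwr : w = u + ∑ i, c.repr ⟨w - u, hwu⟩ i • (c i : E) := by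
    have h1 := congrArg (Subtype.val) (c.sum_repr ⟨w - u, hwu⟩)
    simp only [Submodule.coe_sum, Submodule.coe_smul] at h1
    rw [h1]
    abel
  have hdd : (gram ℝ d).det = ‖u‖ ^ 2 * (gram ℝ c).det := by
    rw [hd, hwr, det_gram_cons_add, det_gram_cons_of_orthogonal]
    · rfl
    · intro i
      rw [hu, real_inner_smul_right, real_inner_comm,
        Submodule.mem_orthogonal_singleton_iff_inner_right.1 (c i).2, mul_zero]
  have hun : ‖u‖ ^ 2 = (‖m‖ ^ 2)⁻¹ := by
    rw [hu, norm_smul, mul_pow, Real.norm_of_nonneg (by positivity)]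
    field_simp
  rw [hdd, hun] at hdb
  rw [← div_le_iff₀ hmm, div_eq_inv_mul]
  exact hdb

end Lattice

/-! ### Covering radius and shortest dual vectors -/

section Flatness

open Module Matrix

universe u

variable {E : Type u} [NormedAddCommGroup E] [InnerProductSpace ℝ E]

/-- A dual vector is determined by its integer pairings with the basis, and Cauchy–Schwarz bounds
these on a ball, so only finitely many dual vectors compete. -/
theorem exists_dual_vector_norm_min {n : ℕ} (b : Basis (Fin (n + 1)) ℝ E) :
    ∃ m : E, m ≠ 0 ∧ (∀ i, ∃ z : ℤ, inner ℝ m (b i) = z) ∧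
      ∀ m' : E, m' ≠ 0 → (∀ i, ∃ z : ℤ, inner ℝ m' (b i) = z) → ‖m‖ ≤ ‖m'‖ := by
  have : FiniteDimensional ℝ E := Module.Finite.of_basis b
  have hinj : ∀ m m' : E, (∀ i, inner ℝ m (b i) = inner ℝ m' (b i)) → m = m' :=
    fun m m' h => InnerProductSpace.ext_inner_right_basis b h
  let D : Set E := {m | m ≠ 0 ∧ ∀ i, ∃ z : ℤ, inner ℝ m (b i) = z}
  obtain ⟨m₀, hm₀⟩ : D.Nonempty := by
    let m₀ := (InnerProductSpace.toDual ℝ E).symm (LinearMap.toContinuousLinearMap (b.coord 0))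
    have h : ∀ i, inner ℝ m₀ (b i) = if i = 0 then (1 : ℝ) else 0 := fun i => by
      rw [InnerProductSpace.toDual_symm_apply]
      simp [Finsupp.single_apply]
    refine ⟨m₀, ?_, fun i => ⟨if i = 0 then 1 else 0, by rw [h]; split_ifs <;> simp⟩⟩
    intro h0
    have := h 0
    rw [h0, inner_zero_left] at this
    simp at this
  have hfin : (D ∩ Metric.closedBall 0 ‖m₀‖).Finite := by
    have hB : (Set.univ.pi fun i : Fin (n + 1) =>
        (Int.cast : ℤ → ℝ) '' Set.Icc (-⌈‖m₀‖ * ‖b i‖⌉) ⌈‖m₀‖ * ‖b i‖⌉).Finite :=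
      Set.Finite.pi fun i => (Set.finite_Icc _ _).image _
    refine Set.Finite.of_finite_image (f := fun m i => inner ℝ m (b i)) (hB.subset ?_) ?_
    · rintro _ ⟨m, ⟨⟨-, hm⟩, hmB⟩, rfl⟩ i -
      obtain ⟨z, hz⟩ := hm i
      refine ⟨z, ?_, hz.symm⟩
      have h1 : |(z : ℝ)| ≤ ‖m₀‖ * ‖b i‖ := by
        rw [← hz]
        refine (abs_real_inner_le_norm _ _).trans ?_
        have := mem_closedBall_zero_iff.1 hmB
        gcongr
      have h2 : |(z : ℝ)| ≤ (⌈‖m₀‖ * ‖b i‖⌉ : ℤ) := h1.trans (Int.le_ceil _)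
      rw [Set.mem_Icc, ← abs_le]
      exact_mod_cast h2
    · intro m _ m' _ h
      exact hinj m m' fun i => congrFun h i
  obtain ⟨m, ⟨hmD, hmB⟩, hmin⟩ := Set.exists_min_image _ norm hfin
    ⟨m₀, hm₀, mem_closedBall_zero_iff.2 le_rfl⟩
  refine ⟨m, hmD.1, hmD.2, fun m' h0 h1 => ?_⟩
  rcases le_total ‖m'‖ ‖m₀‖ with h | h
  · exact hmin m' ⟨⟨h0, h1⟩, mem_closedBall_zero_iff.2 h⟩
  · exact (mem_closedBall_zero_iff.1 hmB).trans h

/-- If `g` generates the ideal of the pairings, `g⁻¹ • m` is again a dual vector, so minimality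
forces `|g| = 1`. -/
theorem exists_inner_eq_one_of_norm_min {n : ℕ} (b : Basis (Fin n) ℝ E) {m : E} (hm0 : m ≠ 0)
    (hm : ∀ i, ∃ z : ℤ, inner ℝ m (b i) = z)
    (hmin : ∀ m' : E, m' ≠ 0 → (∀ i, ∃ z : ℤ, inner ℝ m' (b i) = z) → ‖m‖ ≤ ‖m'‖) :
    ∃ w ∈ Submodule.span ℤ (Set.range b), inner ℝ m w = 1 := by
  choose z hz using hm
  obtain ⟨g, hg⟩ := (IsPrincipalIdealRing.principal (Ideal.span (Set.range z))).principal
  have hdvd : ∀ i, g ∣ z i := fun i => by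
    have : z i ∈ Ideal.span (Set.range z) := Ideal.subset_span ⟨i, rfl⟩
    rw [hg] at this
    exact Ideal.mem_span_singleton.1 this
  have hgm : g ∈ Ideal.span (Set.range z) := by
    rw [hg]
    exact Submodule.mem_span_singleton_self g
  obtain ⟨c, hc⟩ := Ideal.mem_span_range_iff_exists_fun.1 hgm
  have hw : inner ℝ m (∑ i, c i • b i) = (g : ℝ) := by
    rw [inner_sum, ← hc, Int.cast_sum]
    refine Finset.sum_congr rfl fun i _ => ?_
    rw [← Int.cast_smul_eq_zsmul ℝ, real_inner_smul_right, hz, Int.cast_mul]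
  have hg0 : g ≠ 0 := by
    rintro rfl
    refine hm0 (InnerProductSpace.ext_inner_right_basis b fun i => ?_)
    rw [hz, inner_zero_left, zero_dvd_iff.1 (hdvd i), Int.cast_zero]
  have hgR : (g : ℝ) ≠ 0 := by exact_mod_cast hg0
  have hg1 : |g| = 1 := by
    have h1 := hmin ((g : ℝ)⁻¹ • m) (smul_ne_zero (inv_ne_zero hgR) hm0) fun i => by
      obtain ⟨k, hk⟩ := hdvd i
      refine ⟨k, ?_⟩
      rw [real_inner_smul_left, hz, hk, Int.cast_mul, inv_mul_cancel_left₀ hgR]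
    rw [norm_smul, norm_inv, Real.norm_eq_abs] at h1
    have hmpos : 0 < ‖m‖ := norm_pos_iff.2 hm0
    have hgpos : 0 < |(g : ℝ)| := abs_pos.2 hgR
    have h2 : |(g : ℝ)| ≤ 1 := by
      rw [inv_mul_eq_div, le_div_iff₀ hgpos] at h1
      nlinarith
    have h3 : |g| ≤ 1 := by exact_mod_cast h2
    have := Int.one_le_abs hg0
    omega
  refine ⟨g • ∑ i, c i • b i, Submodule.smul_mem _ _ (Submodule.sum_mem _ fun i _ =>
    Submodule.smul_mem _ _ (Submodule.subset_span ⟨i, rfl⟩)), ?_⟩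
  rw [← Int.cast_smul_eq_zsmul ℝ, real_inner_smul_right, hw]
  have : g * g = 1 := by rw [← abs_mul_abs_self, hg1, one_mul]
  exact_mod_cast this

/-- A lattice whose nonzero dual vectors all have norm at least `r` has covering radius at most
`2 ^ n / r`. -/
theorem exists_norm_sub_le_of_le_norm_dual {n : ℕ} (b : Basis (Fin n) ℝ E) {r : ℝ} (hr : 0 < r)
    (h : ∀ m : E, m ≠ 0 → (∀ i, ∃ z : ℤ, inner ℝ m (b i) = z) → r ≤ ‖m‖) (y : E) :
    ∃ v ∈ Submodule.span ℤ (Set.range b), ‖y - v‖ ≤ 2 ^ n / r := by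
  induction n generalizing E r with
  | zero =>
    refine ⟨0, zero_mem _, ?_⟩
    rw [← b.sum_repr y]
    simp [hr.le]
  | succ n ih =>
    obtain ⟨m, hm0, hm, hmin⟩ := exists_dual_vector_norm_min b
    obtain ⟨w, hwΓ, hmw⟩ := exists_inner_eq_one_of_norm_min b hm0 hm hmin
    obtain ⟨c, hcΓ, hcomb, -⟩ := exists_basis_orthogonal b hm hwΓ hmw
    have hrm : r ≤ ‖m‖ := h m hm0 hm
    have hmpos : 0 < ‖m‖ := norm_pos_iff.2 hm0
    have hdual : ∀ m' : (ℝ ∙ m)ᗮ, m' ≠ 0 → (∀ i, ∃ z : ℤ, inner ℝ m' (c i) = z) →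
        2 / 3 * r ≤ ‖m'‖ := by
      intro m' hm'0 hm'
      -- Adding `β • m` makes the pairing with `w` an integer, so `m' + β • m` is dual to the whole
      -- lattice. As `|β| ≤ 1/2`, minimality of `‖m‖` gives `‖m'‖² ≥ 3/4 ‖m‖²`, and `2/3 < √3/2`.
      set β : ℝ := round (inner ℝ (m' : E) w) - inner ℝ (m' : E) w with hβ
      have hβ2 : |β| ≤ 1 / 2 := by
        rw [hβ, abs_sub_comm]
        exact abs_sub_round _
      have horth : inner ℝ m (m' : E) = 0 :=
        Submodule.mem_orthogonal_singleton_iff_inner_right.1 m'.2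
      have hnorm : ‖(m' : E) + β • m‖ ^ 2 = ‖m'‖ ^ 2 + β ^ 2 * ‖m‖ ^ 2 := by
        rw [norm_add_sq_real, real_inner_smul_right, real_inner_comm, horth, norm_smul, mul_pow,
          Real.norm_eq_abs, sq_abs, Submodule.coe_norm]
        ring
      have hpos' : 0 < ‖m'‖ := norm_pos_iff.2 hm'0
      have hne : (m' : E) + β • m ≠ 0 := by
        intro h0
        rw [h0, norm_zero] at hnorm
        nlinarith [sq_nonneg (β * ‖m‖)]
      have hle := hmin _ hne fun i => by
        obtain ⟨z, hz⟩ := hm i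
        obtain ⟨k, hk⟩ := hcomb (b i - z • w)
          (sub_mem (Submodule.subset_span ⟨i, rfl⟩) (Submodule.smul_mem _ _ hwΓ)) (by
            rw [inner_sub_right, ← Int.cast_smul_eq_zsmul ℝ, real_inner_smul_right, hmw, hz]
            ring)
        obtain ⟨t, ht⟩ : ∃ t : ℤ, inner ℝ (m' : E) (b i - z • w) = t := by
          choose s hs using hm'
          refine ⟨∑ j, k j * s j, ?_⟩
          rw [hk, inner_sum, Int.cast_sum]
          refine Finset.sum_congr rfl fun j _ => ?_
          rw [← Int.cast_smul_eq_zsmul ℝ, real_inner_smul_right, ← Submodule.coe_inner, hs,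
            Int.cast_mul]
        refine ⟨t + z * round (inner ℝ (m' : E) w), ?_⟩
        rw [inner_sub_right, ← Int.cast_smul_eq_zsmul ℝ, real_inner_smul_right] at ht
        rw [inner_add_left, real_inner_smul_left, hz]
        push_cast
        rw [← ht, hβ]
        ring
      have hsq : ‖m‖ ^ 2 ≤ ‖m'‖ ^ 2 + 1 / 4 * ‖m‖ ^ 2 := by
        have h1 : ‖m‖ ^ 2 ≤ ‖(m' : E) + β • m‖ ^ 2 := by gcongr
        have h2 : β ^ 2 ≤ 1 / 4 := by
          rw [← sq_abs]
          nlinarith [abs_nonneg β]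
        rw [hnorm] at h1
        nlinarith [sq_nonneg ‖m‖]
      refine le_of_sq_le_sq ?_ hpos'.le
      nlinarith
    set t : ℤ := round (inner ℝ m y) with ht
    set s : ℝ := inner ℝ m y - t with hs
    have hs2 : |s| ≤ 1 / 2 := abs_sub_round _
    have hmm : 0 < ‖m‖ ^ 2 := by positivity
    have hy' : y - t • w - (s / ‖m‖ ^ 2) • m ∈ (ℝ ∙ m)ᗮ := by
      rw [Submodule.mem_orthogonal_singleton_iff_inner_right, inner_sub_right, inner_sub_right,
        ← Int.cast_smul_eq_zsmul ℝ, real_inner_smul_right, real_inner_smul_right, hmw,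
        real_inner_self_eq_norm_sq, div_mul_cancel₀ _ hmm.ne', hs]
      ring
    obtain ⟨v, hv, hvn⟩ := ih c (by positivity) hdual ⟨_, hy'⟩
    have hvΓ : (v : E) ∈ Submodule.span ℤ (Set.range b) := by
      clear hvn
      induction hv using Submodule.span_induction with
      | mem x hx => obtain ⟨i, rfl⟩ := hx; exact hcΓ i
      | zero => exact zero_mem _
      | add x y _ _ hx hy => exact add_mem hx hy
      | smul a x _ hx => exact Submodule.smul_mem _ a hx
    refine ⟨v + t • w, add_mem hvΓ (Submodule.smul_mem _ _ hwΓ), ?_⟩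
    have h1 : y - (v + t • w) = (y - t • w - (s / ‖m‖ ^ 2) • m - v) + (s / ‖m‖ ^ 2) • m := by
      abel
    have h2 : ‖(s / ‖m‖ ^ 2) • m‖ ≤ 1 / 2 / r := by
      rw [norm_smul, norm_div, Real.norm_eq_abs, norm_pow, norm_norm]
      have : |s| / ‖m‖ ^ 2 * ‖m‖ = |s| / ‖m‖ := by field_simp
      rw [this]
      gcongr
    have h3 : ‖y - t • w - (s / ‖m‖ ^ 2) • m - v‖ ≤ 2 ^ n / (2 / 3 * r) := hvn
    rw [h1]
    refine (norm_add_le _ _).trans ((add_le_add h3 h2).trans ?_)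
    -- The induction closes because `3/2 * 2^n + 1/2 ≤ 2^(n+1)`.
    have h4 : (1 : ℝ) ≤ 2 ^ n := one_le_pow₀ (by norm_num)
    have h5 : (2 : ℝ) ^ n / (2 / 3 * r) = 3 / 2 * 2 ^ n / r := by field_simp
    rw [h5, ← add_div, pow_succ]
    gcongr
    linarith

end Flatness

/-! ### Lattice points along a ray, or a dual obstruction -/

section Ray

open Module Matrix

variable {E : Type*} [NormedAddCommGroup E] [InnerProductSpace ℝ E]

/-- The map acting as `α` on the line through the unit vector `X` and as `β` on its orthogonal
complement. -/
noncomputable def axisScale (X : E) (α β : ℝ) : E →ₗ[ℝ] E :=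
  β • LinearMap.id + (α - β) • (innerₛₗ ℝ X).smulRight X

theorem axisScale_apply (X : E) (α β : ℝ) (v : E) :
    axisScale X α β v = β • v + ((α - β) * inner ℝ X v) • X := by
  simp [axisScale, mul_smul]

theorem inner_axisScale (X : E) (α β : ℝ) (u v : E) :
    inner ℝ (axisScale X α β u) v = inner ℝ u (axisScale X α β v) := by
  simp only [axisScale_apply, inner_add_left, inner_add_right, real_inner_smul_left,
    real_inner_smul_right, real_inner_comm u X]
  ring

theorem axisScale_axisScale {X : E} (hX : ‖X‖ = 1) (α β α' β' : ℝ) (v : E) :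
    axisScale X α β (axisScale X α' β' v) = axisScale X (α * α') (β * β') v := by
  simp only [axisScale_apply, inner_add_right, real_inner_smul_right, real_inner_self_eq_norm_sq,
    hX, smul_add, smul_smul, add_assoc, ← add_smul]
  congr 2
  ring

theorem axisScale_one_one (X v : E) : axisScale X 1 1 v = v := by
  simp [axisScale_apply]

theorem inner_axisScale_self {X : E} (hX : ‖X‖ = 1) (α β : ℝ) (v : E) :
    inner ℝ X (axisScale X α β v) = α * inner ℝ X v := by
  rw [axisScale_apply, inner_add_right, real_inner_smul_right, real_inner_smul_right,
    real_inner_self_eq_norm_sq, hX]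
  ring

theorem norm_sq_sub_inner_smul {X : E} (hX : ‖X‖ = 1) (v : E) :
    ‖v‖ ^ 2 = inner ℝ X v ^ 2 + ‖v - inner ℝ X v • X‖ ^ 2 := by
  rw [norm_sub_sq_real, real_inner_smul_right, real_inner_comm, norm_smul, hX, mul_one,
    Real.norm_eq_abs, sq_abs]
  ring

theorem axisScale_sub_inner_smul {X : E} (hX : ‖X‖ = 1) (α β : ℝ) (v : E) :
    axisScale X α β v - inner ℝ X (axisScale X α β v) • X = β • (v - inner ℝ X v • X) := by
  rw [inner_axisScale_self hX, axisScale_apply]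
  module

theorem norm_axisScale_le {X : E} (hX : ‖X‖ = 1) {α β : ℝ} (hα : 0 ≤ α) (hαβ : α ≤ β) (v : E) :
    ‖axisScale X α β v‖ ≤ β * ‖v‖ := by
  have hβ : 0 ≤ β := hα.trans hαβ
  refine le_of_sq_le_sq ?_ (by positivity)
  rw [norm_sq_sub_inner_smul hX, axisScale_sub_inner_smul hX, inner_axisScale_self hX, norm_smul,
    mul_pow, mul_pow, mul_pow, norm_sq_sub_inner_smul hX v, Real.norm_eq_abs, sq_abs, mul_add]
  gcongr

/-- Either the lattice has a point near the far half of the segment from `0` to `Q • X`, or it has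
a primitive dual vector that is short and almost orthogonal to `X`. -/
theorem exists_near_segment_or_dual {n : ℕ} (b : Basis (Fin (n + 1)) ℝ E) {X : E} (hX : ‖X‖ = 1)
    {Q ρ : ℝ} (hρ : 0 < ρ) (hρQ : ρ ≤ Q) :
    (∃ s, Q / 2 ≤ s ∧ s ≤ Q ∧ ∃ v ∈ Submodule.span ℤ (Set.range b), ‖v - s • X‖ ≤ ρ / 4) ∨
    ∃ m w : E, (∀ i, ∃ z : ℤ, inner ℝ m (b i) = z) ∧ w ∈ Submodule.span ℤ (Set.range b) ∧
      inner ℝ m w = 1 ∧ |inner ℝ m X| ≤ 4 * 2 ^ (n + 1) / Q ∧ ‖m‖ ≤ 4 * 2 ^ (n + 1) / ρ := by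
  have hQ : 0 < Q := hρ.trans_le hρQ
  set r : ℝ := 4 * 2 ^ (n + 1) with hr
  let T : E ≃ₗ[ℝ] E := LinearEquiv.ofLinearMap (axisScale X Q⁻¹ ρ⁻¹) (axisScale X Q ρ)
    (LinearMap.ext fun v => by
      simp [axisScale_axisScale hX, inv_mul_cancel₀ hQ.ne', inv_mul_cancel₀ hρ.ne',
        axisScale_one_one])
    (LinearMap.ext fun v => by
      simp [axisScale_axisScale hX, mul_inv_cancel₀ hQ.ne', mul_inv_cancel₀ hρ.ne',
        axisScale_one_one])
  have hT : ∀ v, T v = axisScale X Q⁻¹ ρ⁻¹ v := fun v => rfl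
  let b' : Basis (Fin (n + 1)) ℝ E := b.map T
  have hspan : ∀ v ∈ Submodule.span ℤ (Set.range b'),
      ∃ u ∈ Submodule.span ℤ (Set.range b), T u = v := fun v hv => by
    induction hv using Submodule.span_induction with
    | mem x hx =>
      obtain ⟨i, rfl⟩ := hx
      exact ⟨b i, Submodule.subset_span ⟨i, rfl⟩, (b.map_apply T i).symm⟩
    | zero => exact ⟨0, zero_mem _, map_zero _⟩
    | add x y _ _ hx hy =>
      obtain ⟨u, hu, rfl⟩ := hx
      obtain ⟨u', hu', rfl⟩ := hy
      exact ⟨u + u', add_mem hu hu', map_add _ _ _⟩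
    | smul c x _ hx =>
      obtain ⟨u, hu, rfl⟩ := hx
      exact ⟨c • u, Submodule.smul_mem _ _ hu, map_zsmul T c u⟩
  have hadj : ∀ u v, inner ℝ (T u) v = inner ℝ u (T v) := fun u v => inner_axisScale X _ _ u v
  by_cases h : ∀ m : E, m ≠ 0 → (∀ i, ∃ z : ℤ, inner ℝ m (b' i) = z) → r ≤ ‖m‖
  · left
    -- In rescaled coordinates the ball of radius `1/4` about `3/4 • X` has axial coordinates in
    -- `[1/2, 1]`, that is, the far half of the segment.
    obtain ⟨v', hv', hn⟩ := exists_norm_sub_le_of_le_norm_dual b' (by positivity) h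
      ((3 / 4 : ℝ) • X)
    obtain ⟨v, hv, rfl⟩ := hspan v' hv'
    have hq : (2 : ℝ) ^ (n + 1) / r = 1 / 4 := by
      rw [hr]
      field_simp
    rw [hq, norm_sub_rev] at hn
    have hin : inner ℝ X (T v - (3 / 4 : ℝ) • X) = Q⁻¹ * inner ℝ X v - 3 / 4 := by
      rw [inner_sub_right, hT, inner_axisScale_self hX, real_inner_smul_right,
        real_inner_self_eq_norm_sq, hX]
      ring
    have hsq := norm_sq_sub_inner_smul hX (T v - (3 / 4 : ℝ) • X)
    have h1 : T v - (3 / 4 : ℝ) • X - inner ℝ X (T v - (3 / 4 : ℝ) • X) • X =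
        ρ⁻¹ • (v - inner ℝ X v • X) := by
      rw [← axisScale_sub_inner_smul hX Q⁻¹ ρ⁻¹, hin, inner_axisScale_self hX, hT]
      module
    rw [h1, hin] at hsq
    have hsq' : ‖T v - (3 / 4 : ℝ) • X‖ ^ 2 ≤ (1 / 4) ^ 2 := by gcongr
    have h2 : |Q⁻¹ * inner ℝ X v - 3 / 4| ≤ 1 / 4 := by
      refine abs_le_of_sq_le_sq ?_ (by norm_num)
      nlinarith [sq_nonneg ‖ρ⁻¹ • (v - inner ℝ X v • X)‖]
    have h3 : ‖ρ⁻¹ • (v - inner ℝ X v • X)‖ ≤ 1 / 4 := by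
      refine le_of_sq_le_sq ?_ (by norm_num)
      nlinarith [sq_nonneg (Q⁻¹ * inner ℝ X v - 3 / 4)]
    rw [norm_smul, Real.norm_of_nonneg (by positivity), inv_mul_le_iff₀ hρ] at h3
    obtain ⟨h4, h5⟩ := abs_le.1 h2
    have h6 : Q * (Q⁻¹ * inner ℝ X v) = inner ℝ X v := by field_simp
    refine ⟨inner ℝ X v, ?_, ?_, v, hv, by linarith⟩
    · rw [← h6]
      nlinarith
    · rw [← h6]
      nlinarith
  · right
    push Not at h
    obtain ⟨m₁, hm₁, hm₁z, hm₁r⟩ := h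
    obtain ⟨m, hm0, hmz, hmin⟩ := exists_dual_vector_norm_min b'
    obtain ⟨w', hw', hmw⟩ := exists_inner_eq_one_of_norm_min b' hm0 hmz hmin
    obtain ⟨w, hw, rfl⟩ := hspan w' hw'
    have hmr : ‖m‖ ≤ r := (hmin m₁ hm₁ hm₁z).trans hm₁r.le
    refine ⟨T m, w, fun i => ?_, hw, by rw [hadj, hmw], ?_, ?_⟩
    · obtain ⟨z, hz⟩ := hmz i
      exact ⟨z, by rw [hadj, ← hz, b.map_apply T i]⟩
    · rw [real_inner_comm, hT, inner_axisScale_self hX, abs_mul, abs_inv, abs_of_pos hQ,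
        inv_mul_eq_div]
      gcongr
      refine (abs_real_inner_le_norm _ _).trans ?_
      rwa [hX, one_mul]
    · rw [hT]
      refine (norm_axisScale_le hX (by positivity) (by gcongr) m).trans ?_
      rw [inv_mul_eq_div]
      gcongr

/-- A positive integer is at least 1. Sublattices inherit integrality, so this keeps all covolumes
in the descent at least 1, and gives `s ≥ 1` in rank one. -/
theorem one_le_det_gram {n : ℕ} (b : Basis (Fin n) ℝ E)
    (hb : ∀ i j, ∃ z : ℤ, inner ℝ (b i) (b j) = z) : 1 ≤ (gram ℝ b).det := by
  have hpos : 0 < (gram ℝ b).det := (posDef_gram_of_linearIndependent b.linearIndependent).det_pos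
  choose z hz using hb
  have h : gram ℝ b = (of z).map (Int.castRingHom ℝ) := by
    ext i j
    simp [gram_apply, hz]
  rw [h, ← RingHom.mapMatrix_apply, ← RingHom.map_det] at hpos ⊢
  simp only [eq_intCast] at hpos ⊢
  exact_mod_cast hpos

/-- The arithmetic of one descent step, from covolume `h` to `h'`: the minimum collects the two
upper limits on `s`. The limit `Q` uses `(1 - a) F ≤ 1`; the tilt limit uses `(B h')^a ≤ B h'` and
accounts for the exponent `1 + a F`. -/
theorem descent_bounds {a F R Q h h' B r : ℝ} (ha : 0 < a) (ha1 : a ≤ 1)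
    (haF : (1 - a) * F ≤ 1) (hR : 0 < R) (hR1 : R ≤ 1) (hh : 1 ≤ h) (hh' : 1 ≤ h') (hB : 1 ≤ B)
    (hr : 1 ≤ r) (hQ : 4 * r * B * h ≤ Q * R ^ (1 + a * F))
    (hh'le : h' ≤ h * (r / (Q ^ (1 - a) * R))) :
    B * h' ≤ min Q ((R * Q * h' / (4 * r * h)) ^ a⁻¹) * R ^ F := by
  have hBh : 1 ≤ r * B * h :=
    one_le_mul_of_one_le_of_one_le (one_le_mul_of_one_le_of_one_le hr hB) hh
  have hRp : 0 < R ^ (1 + a * F) := by positivity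
  have hQ0 : 0 < Q := by
    by_contra! hneg
    nlinarith
  have hRF : 0 < R ^ F := by positivity
  rcases min_choice Q ((R * Q * h' / (4 * r * h)) ^ a⁻¹) with hmin | hmin <;> rw [hmin]
  · have hQR : R ^ (-(1 + a * F)) ≤ Q := by
      rw [Real.rpow_neg hR.le, inv_le_iff_one_le_mul₀ hRp]
      nlinarith
    have hQa : R ^ (-(1 + a * F) * (1 - a)) ≤ Q ^ (1 - a) := by
      rw [Real.rpow_mul hR.le]
      exact Real.rpow_le_rpow (by positivity) hQR (by linarith)
    have hexp : R ^ (1 + a * F) ≤ Q ^ (1 - a) * R * R ^ F := by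
      calc R ^ (1 + a * F) ≤ R ^ (-(1 + a * F) * (1 - a) + 1 + F) := by
            apply Real.rpow_le_rpow_of_exponent_ge hR hR1
            nlinarith
        _ = R ^ (-(1 + a * F) * (1 - a)) * R * R ^ F := by
            rw [Real.rpow_add hR, Real.rpow_add hR, Real.rpow_one]
        _ ≤ _ := by gcongr
    have hQR0 : 0 < Q ^ (1 - a) * R := by positivity
    calc B * h' ≤ B * (h * (r / (Q ^ (1 - a) * R))) := by gcongr
      _ = r * B * h / (Q ^ (1 - a) * R) := by ring
      _ ≤ Q * R ^ (1 + a * F) / (Q ^ (1 - a) * R) :=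
          div_le_div_of_nonneg_right (by linarith) hQR0.le
      _ ≤ Q * (Q ^ (1 - a) * R * R ^ F) / (Q ^ (1 - a) * R) := by gcongr
      _ = Q * R ^ F := by field_simp
  · rw [← div_le_iff₀ hRF]
    have hBh' : 1 ≤ B * h' := one_le_mul_of_one_le_of_one_le hB hh'
    rw [Real.le_rpow_inv_iff_of_pos (by positivity) (by positivity) ha,
      Real.div_rpow (by positivity) hRF.le, ← Real.rpow_mul hR.le, mul_comm F a,
      div_le_div_iff₀ (by positivity) (by positivity)]
    have h1 : (B * h') ^ a ≤ B * h' := by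
      simpa using Real.rpow_le_rpow_of_exponent_le hBh' ha1
    rw [Real.rpow_add hR, Real.rpow_one] at hQ
    calc (B * h') ^ a * (4 * r * h) ≤ B * h' * (4 * r * h) := by gcongr
      _ = 4 * r * B * h * h' := by ring
      _ ≤ Q * (R * R ^ (a * F)) * h' := by gcongr
      _ = _ := by ring

end Ray

/-! ### Induction on the rank -/

section Descent

open Module Matrix

/-- Rank one: the generator of the lattice lies on the ray itself, up to sign. -/
theorem exists_lattice_point_on_ray {E : Type*} [NormedAddCommGroup E] [InnerProductSpace ℝ E]
    (b : Basis (Fin 1) ℝ E) {X : E} (hX : ‖X‖ = 1) :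
    ∃ v ∈ Submodule.span ℤ (Set.range b), v = ‖b 0‖ • X := by
  have hb : b 0 ∈ Submodule.span ℤ (Set.range b) := Submodule.subset_span ⟨0, rfl⟩
  have hXb : X = b.repr X 0 • b 0 := by
    conv_lhs => rw [← b.sum_repr X]
    simp
  set t := b.repr X 0 with ht
  have hn : |t| * ‖b 0‖ = 1 := by
    rw [← hX, hXb, norm_smul, Real.norm_eq_abs]
  rcases abs_cases t with ⟨h, -⟩ | ⟨h, -⟩
  · refine ⟨b 0, hb, ?_⟩
    rw [hXb, smul_smul, mul_comm, ← h, hn, one_smul]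
  · refine ⟨-b 0, neg_mem hb, ?_⟩
    have : ‖b 0‖ * t = -1 := by
      rw [← hn, h]
      ring
    rw [hXb, smul_smul, this, neg_one_smul]

theorem norm_sub_normalize_le {E : Type*} [NormedAddCommGroup E] [InnerProductSpace ℝ E]
    {X Y : E} (hX : ‖X‖ = 1) (hY : Y ≠ 0) : ‖X - ‖Y‖⁻¹ • Y‖ ≤ 2 * ‖X - Y‖ := by
  have hY0 : ‖Y‖ ≠ 0 := norm_ne_zero_iff.2 hY
  have h1 : ‖Y - ‖Y‖⁻¹ • Y‖ ≤ ‖X - Y‖ := by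
    have : Y - ‖Y‖⁻¹ • Y = (1 - ‖Y‖⁻¹) • Y := by rw [sub_smul, one_smul]
    rw [this, norm_smul, Real.norm_eq_abs, ← abs_of_nonneg (norm_nonneg Y), ← abs_mul,
      abs_of_nonneg (norm_nonneg Y), sub_mul, inv_mul_cancel₀ hY0, one_mul, ← hX, abs_sub_comm]
    exact abs_norm_sub_norm_le X Y
  calc ‖X - ‖Y‖⁻¹ • Y‖ = ‖(X - Y) + (Y - ‖Y‖⁻¹ • Y)‖ := by congr 1; abel
    _ ≤ ‖X - Y‖ + ‖Y - ‖Y‖⁻¹ • Y‖ := norm_add_le _ _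
    _ ≤ 2 * ‖X - Y‖ := by linarith

theorem norm_sub_smul_le_of_near {E : Type*} [NormedAddCommGroup E] [NormedSpace ℝ E]
    {a s R δ K : ℝ} (hs : 0 < s) {v X Z : E} (hv : ‖v - s • Z‖ ≤ s ^ (1 - a) * (R / 2))
    (hXZ : ‖X - Z‖ ≤ 2 * δ) (hsK : s ^ a ≤ K) (hK : K * (2 * δ) = R / 2) :
    ‖v - s • X‖ ≤ s ^ (1 - a) * R := by
  have hδ : 0 ≤ 2 * δ := (norm_nonneg _).trans hXZ
  have h1 : v - s • X = (v - s • Z) - s • (X - Z) := by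
    rw [smul_sub]
    abel
  have h2 : ‖s • (X - Z)‖ ≤ s ^ (1 - a) * (R / 2) := by
    calc ‖s • (X - Z)‖ ≤ s * (2 * δ) := by
          rw [norm_smul, Real.norm_of_nonneg hs.le]
          gcongr
      _ = s ^ (1 - a) * (s ^ a * (2 * δ)) := by
          rw [← mul_assoc (s ^ (1 - a)), ← Real.rpow_add hs, sub_add_cancel, Real.rpow_one]
      _ ≤ s ^ (1 - a) * (R / 2) := by
          rw [← hK]
          gcongr
  rw [h1]
  refine (norm_sub_le _ _).trans ?_
  linarith

theorem rpow_one_sub_le_two_mul {a Q s : ℝ} (ha : 0 ≤ a) (ha1 : a ≤ 1) (hQ : 0 < Q)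
    (hs : Q / 2 ≤ s) : Q ^ (1 - a) ≤ 2 * s ^ (1 - a) := by
  calc Q ^ (1 - a) ≤ (2 * s) ^ (1 - a) :=
        Real.rpow_le_rpow hQ.le (by linarith) (by linarith)
    _ = 2 ^ (1 - a) * s ^ (1 - a) := Real.mul_rpow (by norm_num) (by linarith)
    _ ≤ 2 * s ^ (1 - a) := by
        have : (2 : ℝ) ^ (1 - a) ≤ 2 := by
          simpa using Real.rpow_le_rpow_of_exponent_le (x := 2) (by norm_num)
            (by linarith : 1 - a ≤ 1)
        have h2 : 0 ≤ s ^ (1 - a) := Real.rpow_nonneg (by linarith) _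
        gcongr

/-- A lattice with integral Gram matrix and covolume `h` has a point close to the ray spanned by
the unit vector `X`, as soon as `h` is small compared to `Q * R ^ ∑ a ^ i`. -/
theorem exists_lattice_point_near_ray {a : ℝ} (ha : 0 < a) (ha1 : a ≤ 1) (k : ℕ) :
    ∃ C : ℝ, 1 ≤ C ∧ ∀ (E : Type) [NormedAddCommGroup E] [InnerProductSpace ℝ E]
      (b : Basis (Fin (k + 1)) ℝ E), (∀ i j, ∃ z : ℤ, inner ℝ (b i) (b j) = z) →
      ∀ X : E, ‖X‖ = 1 → ∀ Q R : ℝ, 0 < R → R ≤ 1 →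
      C * √(gram ℝ b).det ≤ Q * R ^ (∑ i ∈ Finset.range k, a ^ i) →
      ∃ s, 1 ≤ s ∧ s ≤ Q ∧ ∃ v ∈ Submodule.span ℤ (Set.range b),
        ‖v - s • X‖ ≤ s ^ (1 - a) * R := by
  induction k with
  | zero =>
    refine ⟨1, le_rfl, fun E _ _ b hb X hX Q R hR hR1 hQ => ?_⟩
    have hdet : (gram ℝ b).det = ‖b 0‖ ^ 2 :=
      (det_fin_one _).trans (real_inner_self_eq_norm_sq _)
    have h1 := one_le_det_gram b hb
    rw [hdet] at hQ h1
    rw [Real.sqrt_sq (norm_nonneg _)] at hQ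
    obtain ⟨v, hv, hvX⟩ := exists_lattice_point_on_ray b hX
    refine ⟨‖b 0‖, by nlinarith [norm_nonneg (b 0)], by simpa using hQ, v, hv, ?_⟩
    rw [hvX, sub_self, norm_zero]
    positivity
  | succ k ih =>
    obtain ⟨C, hC1, ih⟩ := ih
    set F := ∑ i ∈ Finset.range k, a ^ i with hF
    have hF0 : 0 ≤ F := Finset.sum_nonneg fun i _ => by positivity
    set r : ℝ := 4 * 2 ^ (k + 1 + 1) with hr
    have hr1 : 1 ≤ r := by
      have : (1 : ℝ) ≤ 2 ^ (k + 1 + 1) := one_le_pow₀ (by norm_num)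
      linarith
    -- The factor `2^F` pays for passing from `R` to `R / 2`; the other half of `R` is spent on
    -- tilting the ray.
    set B : ℝ := C * 2 ^ F with hBdef
    have hB1 : 1 ≤ B :=
      one_le_mul_of_one_le_of_one_le hC1 (Real.one_le_rpow (by norm_num) hF0)
    have hrB : 1 ≤ r * B := one_le_mul_of_one_le_of_one_le hr1 hB1
    refine ⟨4 * r * B, by linarith, fun E _ _ b hb X hX Q R hR hR1 hQ => ?_⟩
    rw [sum_range_pow_succ, ← hF] at hQ
    have hdet := one_le_det_gram b hb
    set h := √(gram ℝ b).det with hh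
    have hh1 : 1 ≤ h := Real.one_le_sqrt.2 hdet
    have hhsq : h ^ 2 = (gram ℝ b).det := Real.sq_sqrt (by linarith)
    have hRp : R ^ (1 + a * F) ≤ 1 := Real.rpow_le_one hR.le hR1 (by positivity)
    have hRp0 : 0 < R ^ (1 + a * F) := by positivity
    have h4 : 4 ≤ 4 * r * B * h := by nlinarith
    have hQ0 : 0 < Q := by
      by_contra! hneg
      nlinarith
    have hQle : 4 * r * B * h ≤ Q := hQ.trans (mul_le_of_le_one_right hQ0.le hRp)
    have hQ1 : 1 ≤ Q := by linarith
    have hρ0 : 0 < Q ^ (1 - a) * R := by positivity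
    have hρQ : Q ^ (1 - a) * R ≤ Q := by
      have h1 : Q ^ (1 - a) ≤ Q := by
        simpa using Real.rpow_le_rpow_of_exponent_le hQ1 (by linarith : 1 - a ≤ 1)
      have h2 : 0 < Q ^ (1 - a) := by positivity
      nlinarith
    rcases exists_near_segment_or_dual b hX hρ0 hρQ with
      ⟨s, hs1, hs2, v, hv, hvs⟩ | ⟨m, w, hm, hw, hmw, hmX, hmn⟩
    · refine ⟨s, by linarith, hs2, v, hv, hvs.trans ?_⟩
      have h1 := rpow_one_sub_le_two_mul ha.le ha1 hQ0 hs1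
      nlinarith
    · rw [← hr] at hmX hmn
      have hm0 : m ≠ 0 := by
        rintro rfl
        simp at hmw
      have hmpos : 0 < ‖m‖ := norm_pos_iff.2 hm0
      obtain ⟨c, hcΓ, -, hcdet⟩ := exists_basis_orthogonal b hm hw hmw
      have hcint : ∀ i j, ∃ z : ℤ, inner ℝ (c i) (c j) = z := fun i j => by
        refine exists_int_inner_of_mem_span (m := (c i : E)) (fun l => ?_) (hcΓ j)
        rw [real_inner_comm]
        exact exists_int_inner_of_mem_span (hb l) (hcΓ i)
      have hcdet1 := one_le_det_gram c hcint
      set h' := √(gram ℝ c).det with hh'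
      have hh'1 : 1 ≤ h' := Real.one_le_sqrt.2 hcdet1
      have hh'm : h' ≤ h * ‖m‖ := by
        refine le_of_sq_le_sq ?_ (by positivity)
        rw [hh', Real.sq_sqrt (by linarith), mul_pow, hhsq]
        exact hcdet
      have hdesc := descent_bounds ha ha1 (one_sub_mul_sum_range_pow_le ha.le k) hR hR1 hh1
        hh'1 hB1 hr1 hQ (hh'm.trans (by gcongr))
      -- Here `δ` bounds the distance from `X` to `mᗮ`, by `h' ≤ h ‖m‖`. Normalizing the projection
      -- doubles it, and `s * 2δ ≤ s^(1-a) R / 2` amounts to `s^a ≤ R / (4δ)`, the second entry of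
      -- the minimum.
      set Q' := min Q ((R * Q * h' / (4 * r * h)) ^ a⁻¹) with hQ'
      set δ : ℝ := r * h / (Q * h') with hδ
      have hXm : |inner ℝ m X| / ‖m‖ ≤ δ := by
        rw [div_le_iff₀ hmpos]
        refine hmX.trans ?_
        rw [hδ, div_mul_eq_mul_div, div_le_div_iff₀ hQ0 (by positivity)]
        have : r * Q * h' ≤ r * Q * (h * ‖m‖) := by gcongr
        linarith
      have hδ2 : δ ≤ 1 / 2 := by
        rw [hδ, div_le_iff₀ (by positivity)]
        have h1 : r * h ≤ r * B * h := by nlinarith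
        nlinarith
      set Y : E := X - (inner ℝ m X / ‖m‖ ^ 2) • m with hY
      have hYmem : Y ∈ (ℝ ∙ m)ᗮ := by
        rw [Submodule.mem_orthogonal_singleton_iff_inner_right, hY, inner_sub_right,
          real_inner_smul_right, real_inner_self_eq_norm_sq,
          div_mul_cancel₀ _ (by positivity), sub_self]
      have hXY : ‖X - Y‖ ≤ δ := by
        have h1 : X - Y = (inner ℝ m X / ‖m‖ ^ 2) • m := by rw [hY]; abel
        have h2 : ‖(inner ℝ m X / ‖m‖ ^ 2) • m‖ = |inner ℝ m X| / ‖m‖ := by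
          rw [norm_smul, norm_div, Real.norm_eq_abs, norm_pow, norm_norm]
          field_simp
        rw [h1, h2]
        exact hXm
      have hYne : Y ≠ 0 := by
        intro h0
        rw [h0, sub_zero, hX] at hXY
        linarith
      have hYn : ‖(‖Y‖⁻¹ • ⟨Y, hYmem⟩ : (ℝ ∙ m)ᗮ)‖ = 1 := by
        rw [norm_smul, norm_inv, norm_norm, Submodule.coe_norm]
        exact inv_mul_cancel₀ (norm_ne_zero_iff.2 hYne)
      obtain ⟨s, hs1, hsQ, v, hv, hvs⟩ := ih (ℝ ∙ m)ᗮ c hcint _ hYn Q' (R / 2) (by linarith)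
        (by linarith) (by
          rw [Real.div_rpow hR.le (by norm_num), mul_div_assoc', le_div_iff₀ (by positivity)]
          calc C * h' * 2 ^ F = B * h' := by rw [hBdef]; ring
            _ ≤ _ := hdesc)
      have hs0 : 0 < s := by linarith
      refine ⟨s, hs1, hsQ.trans (min_le_left _ _), v, ?_, ?_⟩
      · clear hvs
        induction hv using Submodule.span_induction with
        | mem x hx => obtain ⟨i, rfl⟩ := hx; exact hcΓ i
        | zero => exact zero_mem _
        | add x y _ _ hx hy => exact add_mem hx hy
        | smul l x _ hx => exact Submodule.smul_mem _ l hx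
      · have hvs' : ‖(v : E) - s • (‖Y‖⁻¹ • Y)‖ ≤ s ^ (1 - a) * (R / 2) := hvs
        have h2 := (norm_sub_normalize_le hX hYne).trans (mul_le_mul_of_nonneg_left hXY zero_le_two)
        have h3 : s ^ a ≤ R * Q * h' / (4 * r * h) := by
          rw [← Real.le_rpow_inv_iff_of_pos hs0.le (by positivity) ha]
          exact hsQ.trans (min_le_right _ _)
        refine norm_sub_smul_le_of_near hs0 hvs' h2 h3 ?_
        rw [hδ]
        field_simp
        norm_num

end Descent

/-! ### From lattice points to rational approximation -/

section Approximation

open Module Matrix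

theorem gram_basisFun (n : ℕ) :
    gram ℝ (EuclideanSpace.basisFun (Fin n) ℝ).toBasis = 1 := by
  ext i j
  rw [gram_apply, OrthonormalBasis.coe_toBasis,
    orthonormal_iff_ite.1 (EuclideanSpace.basisFun (Fin n) ℝ).orthonormal, one_apply]

theorem exists_int_coords_of_mem_span {n : ℕ} {v : EuclideanSpace ℝ (Fin n)}
    (hv : v ∈ Submodule.span ℤ (Set.range (EuclideanSpace.basisFun (Fin n) ℝ).toBasis)) :
    ∃ z : Fin n → ℤ, ∀ i, v i = z i := by
  suffices h : ∀ i, ∃ z : ℤ, v i = z from Classical.skolem.1 h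
  intro i
  have hm : ∀ j, ∃ z : ℤ, inner ℝ ((EuclideanSpace.basisFun (Fin n) ℝ).toBasis i)
      ((EuclideanSpace.basisFun (Fin n) ℝ).toBasis j) = z := fun j => by
    rw [← gram_apply, gram_basisFun, one_apply]
    exact ⟨if i = j then 1 else 0, by split_ifs <;> simp⟩
  obtain ⟨z, hz⟩ := exists_int_inner_of_mem_span hm hv
  refine ⟨z, ?_⟩
  rw [← hz, OrthonormalBasis.coe_toBasis, EuclideanSpace.basisFun_apply,
    EuclideanSpace.inner_single_left]
  simp

/-- The lattice is `ℤ^(d+1)`, of covolume 1, and the ray passes through `(1, y)`: a lattice point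
near it is `(q, z)`, with `q` comparable to `s`. -/
theorem exists_approx_of_mem_unit_cube {a : ℝ} (ha : 0 < a) (ha1 : a ≤ 1) (d : ℕ) :
    ∃ C : ℝ, 1 ≤ C ∧ ∀ y : Fin d → ℝ, (∀ i, 0 ≤ y i) → (∀ i, y i ≤ 1) →
      ∀ Q R : ℝ, 0 < R → 2 * (d + 1) * R ≤ 1 →
      C ≤ Q * R ^ (∑ i ∈ Finset.range d, a ^ i) →
      ∃ (q : ℕ) (z : Fin d → ℤ), 1 ≤ q ∧ (q : ℝ) ≤ 2 * Q ∧
        ∀ i, |q * y i - z i| ≤ 4 * (d + 1) * (q : ℝ) ^ (1 - a) * R := by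
  obtain ⟨C, hC1, hC⟩ := exists_lattice_point_near_ray ha ha1 d
  refine ⟨C, hC1, fun y hy0 hy1 Q R hR hRd hQ => ?_⟩
  have hd0 : (0 : ℝ) ≤ d := Nat.cast_nonneg d
  set V : EuclideanSpace ℝ (Fin (d + 1)) := WithLp.toLp 2 (Fin.cons 1 y) with hV
  have hV0 : V 0 = 1 := rfl
  have hVs : ∀ i : Fin d, V i.succ = y i := fun i => rfl
  have hNsq : ‖V‖ ^ 2 = 1 + ∑ i, y i ^ 2 := by
    rw [EuclideanSpace.norm_sq_eq, Fin.sum_univ_succ]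
    simp [hV0, hVs]
  have hN1 : 1 ≤ ‖V‖ := by
    have : 0 ≤ ∑ i, y i ^ 2 := Finset.sum_nonneg fun i _ => sq_nonneg _
    nlinarith [norm_nonneg V]
  have hNd : ‖V‖ ≤ d + 1 := by
    have : ∑ i, y i ^ 2 ≤ d := by
      refine (Finset.sum_le_card_nsmul _ _ 1 fun i _ => ?_).trans (by simp)
      nlinarith [hy0 i, hy1 i]
    nlinarith
  have hNpos : 0 < ‖V‖ := by linarith
  have hXn : ‖‖V‖⁻¹ • V‖ = 1 := by
    rw [norm_smul, norm_inv, norm_norm, inv_mul_cancel₀ hNpos.ne']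
  have hg := gram_basisFun (d + 1)
  obtain ⟨s, hs1, hsQ, v, hv, hvs⟩ := hC _ (EuclideanSpace.basisFun (Fin (d + 1)) ℝ).toBasis
    (fun i j => by
      rw [← gram_apply, hg, one_apply]
      exact ⟨if i = j then 1 else 0, by split_ifs <;> simp⟩)
    (‖V‖⁻¹ • V) hXn Q R hR (by nlinarith)
    (by rw [hg, det_one, Real.sqrt_one, mul_one]; exact hQ)
  obtain ⟨z, hz⟩ := exists_int_coords_of_mem_span hv
  have hs0 : 0 < s := by linarith
  set e : ℝ := s ^ (1 - a) * R with he
  set σ : ℝ := s * ‖V‖⁻¹ with hσ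
  have hσ0 : 0 < σ := by positivity
  have hsσ : s = σ * ‖V‖ := by rw [hσ]; field_simp
  have hcoord : ∀ i, |(z i : ℝ) - σ * V i| ≤ e := fun i => by
    have h1 := (PiLp.norm_apply_le (v - s • ‖V‖⁻¹ • V) i).trans hvs
    rw [PiLp.sub_apply, PiLp.smul_apply, PiLp.smul_apply, hz, Real.norm_eq_abs, smul_eq_mul,
      smul_eq_mul, ← mul_assoc] at h1
    exact h1
  -- The error is at most half of the first coordinate `σ` of `s • X`, which forces `q > 0` and `q ≤
  -- 2Q`.
  have heσ : e ≤ σ / 2 := by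
    have h1 : s ^ (1 - a) ≤ s := by
      simpa using Real.rpow_le_rpow_of_exponent_le hs1 (by linarith : 1 - a ≤ 1)
    have h2 : e ≤ s * R := by rw [he]; gcongr
    have h3 : ‖V‖ * R ≤ 1 / 2 := by nlinarith
    calc e ≤ σ * (‖V‖ * R) := by rw [← mul_assoc, ← hsσ]; exact h2
      _ ≤ σ * (1 / 2) := by gcongr
      _ = σ / 2 := by ring
  have hz0 := abs_le.1 (hcoord 0)
  rw [hV0, mul_one] at hz0
  have hzpos : 0 < z 0 := by
    have : (0 : ℝ) < z 0 := by linarith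
    exact_mod_cast this
  obtain ⟨q, hq⟩ := Int.eq_ofNat_of_zero_le hzpos.le
  have hqz : (z 0 : ℝ) = q := by rw [hq]; simp
  rw [hqz] at hz0
  have hq1 : 1 ≤ q := by omega
  have hq0 : (0 : ℝ) < q := by exact_mod_cast hq1
  have hσs : σ ≤ s := by
    rw [hsσ]
    nlinarith
  refine ⟨q, fun i => z i.succ, hq1, by linarith, fun i => ?_⟩
  have h1 := hcoord i.succ
  rw [hVs] at h1
  have h2 : |(q : ℝ) - σ| ≤ e := abs_le.2 hz0
  have h3 : |q * y i - z i.succ| ≤ 2 * e := by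
    have h4 : q * y i - z i.succ = (q - σ) * y i - (z i.succ - σ * y i) := by ring
    rw [h4]
    refine (abs_sub _ _).trans ?_
    rw [abs_mul, abs_of_nonneg (hy0 i)]
    nlinarith [hy0 i, hy1 i, abs_nonneg ((q : ℝ) - σ)]
  have h5 : s ≤ 2 * (d + 1) * q := by
    rw [hsσ]
    have : σ ≤ 2 * q := by linarith
    calc σ * ‖V‖ ≤ 2 * q * (d + 1) := by gcongr
      _ = _ := by ring
  have h6 : s ^ (1 - a) ≤ 2 * (d + 1) * (q : ℝ) ^ (1 - a) := by
    calc s ^ (1 - a) ≤ (2 * (d + 1) * q) ^ (1 - a) :=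
          Real.rpow_le_rpow hs0.le h5 (by linarith)
      _ = (2 * (d + 1) : ℝ) ^ (1 - a) * (q : ℝ) ^ (1 - a) :=
          Real.mul_rpow (by positivity) hq0.le
      _ ≤ 2 * (d + 1) * (q : ℝ) ^ (1 - a) := by
          gcongr
          simpa using Real.rpow_le_rpow_of_exponent_le (x := (2 * (d + 1) : ℝ)) (by linarith)
            (by linarith : 1 - a ≤ 1)
  refine h3.trans ?_
  calc 2 * e ≤ 2 * (2 * (d + 1) * (q : ℝ) ^ (1 - a) * R) := by rw [he]; gcongr
    _ = _ := by ring

theorem UniformlyApproximable.mono {d : ℕ} {Ψ Ψ' : ℕ → ℕ → ℝ} {S : Set (Fin d → ℝ)}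
    (h : UniformlyApproximable Ψ S) (Q₁ : ℕ)
    (hΨ : ∀ q Q : ℕ, Q₁ ≤ Q → 1 ≤ q → q ≤ Q → Ψ q Q ≤ Ψ' q Q) : UniformlyApproximable Ψ' S := by
  obtain ⟨Q₀, hQ₀, h⟩ := h
  refine ⟨max Q₀ Q₁, lt_max_of_lt_left hQ₀, fun x hx Q hQ => ?_⟩
  obtain ⟨p, q, hq, hqQ, hlt⟩ := h x hx Q ((le_max_left _ _).trans hQ)
  exact ⟨p, q, hq, hqQ, hlt.trans_le (hΨ q Q ((le_max_right _ _).trans hQ) hq hqQ)⟩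

theorem uniformlyApproximable_geom_sum {a : ℝ} (ha : 0 < a) (ha1 : a ≤ 1) {d : ℕ} (hd : 0 < d) :
    ∃ κ : ℝ, 0 < κ ∧ UniformlyApproximable
      (fun q Q => κ * Psi a (∑ i ∈ Finset.range d, a ^ i)⁻¹ q Q)
      (Set.univ : Set (Fin d → ℝ)) := by
  obtain ⟨C, hC1, hC⟩ := exists_approx_of_mem_unit_cube ha ha1 d
  set F := ∑ i ∈ Finset.range d, a ^ i with hF
  have hF0 : 0 < F := Finset.sum_pos (fun i _ => pow_pos ha i) ⟨0, by simpa using hd⟩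
  have hC0 : 0 < C := by linarith
  refine ⟨8 * (d + 1) * (2 * C) ^ F⁻¹, by positivity,
    ⌈2 * C * (2 * (d + 1)) ^ F⌉₊, Nat.ceil_pos.2 (by positivity), fun x _ Q hQ => ?_⟩
  have hQ1 : 2 * C * (2 * (d + 1)) ^ F ≤ Q := Nat.ceil_le.1 hQ
  have hQ0 : (0 : ℝ) < Q := lt_of_lt_of_le (by positivity) hQ1
  -- Chosen so that `(Q / 2) R^F = C`; the half offsets the bound `q ≤ 2 * (Q / 2)`.
  set R : ℝ := (2 * C / Q) ^ F⁻¹ with hR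
  have hR0 : 0 < R := by positivity
  have hRF : R ^ F = 2 * C / Q := Real.rpow_inv_rpow (by positivity) hF0.ne'
  have hRd : 2 * (d + 1) * R ≤ 1 := by
    have h1 : (2 * (d + 1) * R) ^ F ≤ 1 := by
      rw [Real.mul_rpow (by positivity) hR0.le, hRF, mul_div_assoc', div_le_one hQ0]
      linarith
    by_contra! hlt
    exact absurd h1 (not_le.2 (Real.one_lt_rpow hlt hF0))
  obtain ⟨q, z, hq, hqQ, hz⟩ := hC (fun i => Int.fract (x i)) (fun i => Int.fract_nonneg _)
    (fun i => (Int.fract_lt_one _).le) (Q / 2) R hR0 hRd (by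
      rw [hRF]
      apply le_of_eq
      field_simp)
  have hq0 : (0 : ℝ) < q := by exact_mod_cast hq
  have hqQ' : (q : ℝ) ≤ Q := by linarith
  refine ⟨fun i => z i + q * ⌊x i⌋, q, hq, by exact_mod_cast hqQ', ?_⟩
  have hpsi : 8 * (d + 1) * (2 * C) ^ F⁻¹ * Psi a F⁻¹ q Q =
      8 * (d + 1) * (q : ℝ) ^ (-a) * R := by
    rw [Psi, hR, Real.div_rpow (by positivity) hQ0.le, Real.rpow_neg hQ0.le]
    field_simp
  beta_reduce
  rw [hpsi]
  have hpos : 0 < 8 * (d + 1) * (q : ℝ) ^ (-a) * R := by positivity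
  refine (pi_norm_lt_iff hpos).2 fun i => ?_
  rw [Pi.sub_apply, Real.norm_eq_abs]
  have h1 : x i - ((z i + q * ⌊x i⌋ : ℤ) : ℝ) / q = (q * Int.fract (x i) - z i) / q := by
    rw [← Int.self_sub_floor]
    push_cast
    field_simp
    ring
  rw [h1, abs_div, abs_of_pos hq0, div_lt_iff₀ hq0]
  refine (hz i).trans_lt ?_
  have h2 : (q : ℝ) ^ (1 - a) = (q : ℝ) ^ (-a) * q := by
    rw [sub_eq_neg_add, Real.rpow_add hq0, Real.rpow_one]
  rw [h2]
  have h3 : 0 < (d + 1) * ((q : ℝ) ^ (-a) * q) * R := by positivity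
  linarith

/-- Uniform approximability at the critical exponent. -/
theorem exists_uniformlyApproximable {d : ℕ} (hd : 0 < d) (a : ℝ) :
    ∃ κ : ℝ, 0 < κ ∧ UniformlyApproximable (fun q Q => κ * Psi a (fd d a) q Q)
      (Set.univ : Set (Fin d → ℝ)) := by
  have hround : ∀ (x : Fin d → ℝ) (q : ℕ), 1 ≤ q →
      ‖x - fun i => (round (q * x i) : ℝ) / q‖ < 1 / q := fun x q hq => by
    have hq0 : (0 : ℝ) < q := by exact_mod_cast hq
    refine (pi_norm_lt_iff (by positivity)).2 fun i => ?_
    have h1 : x i - (round (q * x i) : ℝ) / q = (q * x i - round (q * x i)) / q := by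
      field_simp
    rw [Pi.sub_apply, Real.norm_eq_abs, h1, abs_div, abs_of_pos hq0]
    gcongr
    linarith [abs_sub_round (q * x i)]
  by_cases h0 : a ≤ 0
  · refine ⟨1, one_pos, 1, one_pos, fun x _ Q hQ =>
      ⟨fun i => round (Q * x i), Q, hQ, le_rfl, ?_⟩⟩
    have hQ0 : (0 : ℝ) < Q := by exact_mod_cast hQ
    have h1 : Psi a (fd d a) Q Q = 1 / Q := by
      rw [Psi, fd, if_pos h0, abs_of_nonpos h0, ← Real.rpow_add hQ0, one_div,
        ← Real.rpow_neg_one]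
      congr 1
      ring
    beta_reduce
    rw [h1, one_mul]
    exact hround x Q hQ
  push Not at h0
  by_cases h1 : a ≤ 1
  · rw [fd, if_neg (not_le.2 h0), if_pos h1]
    exact uniformlyApproximable_geom_sum h0 h1 hd
  push Not at h1
  by_cases h2 : a ≤ 1 + 1 / (d : ℝ)
  -- At `a = 1` the exponent is `1/d`; the excess `q^(a-1)` is then bounded by `Q^(a-1)`.
  · obtain ⟨κ, hκ, h⟩ := uniformlyApproximable_geom_sum one_pos le_rfl hd
    refine ⟨κ, hκ, UniformlyApproximable.mono h 1 fun q Q hQ hq hqQ => ?_⟩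
    have hq0 : (0 : ℝ) < q := by exact_mod_cast hq
    have hQ0 : (0 : ℝ) < Q := by exact_mod_cast hQ
    have hqQ' : (q : ℝ) ≤ Q := by exact_mod_cast hqQ
    rw [fd, if_neg (not_le.2 h0), if_neg (not_le.2 h1), if_pos h2]
    simp only [one_pow, Finset.sum_const, Finset.card_range, nsmul_eq_mul, mul_one, Psi]
    refine mul_le_mul_of_nonneg_left ?_ hκ.le
    calc (q : ℝ) ^ (-1 : ℝ) * (Q : ℝ) ^ (-(d : ℝ)⁻¹)
        = (q : ℝ) ^ (-a) * (q : ℝ) ^ (a - 1) * (Q : ℝ) ^ (-(d : ℝ)⁻¹) := by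
          rw [← Real.rpow_add hq0]
          congr 2
          ring
      _ ≤ (q : ℝ) ^ (-a) * (Q : ℝ) ^ (a - 1) * (Q : ℝ) ^ (-(d : ℝ)⁻¹) := by
          gcongr
      _ = (q : ℝ) ^ (-a) * (Q : ℝ) ^ (-(1 + 1 / (d : ℝ) - a)) := by
          rw [mul_assoc, ← Real.rpow_add hQ0]
          congr 2
          ring
  · refine ⟨1, one_pos, 1, one_pos, fun x _ Q hQ =>
      ⟨fun i => round (((1 : ℕ) : ℝ) * x i), 1, le_rfl, hQ, ?_⟩⟩
    have h3 : Psi a (fd d a) 1 Q = 1 / ((1 : ℕ) : ℝ) := by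
      rw [Psi, fd, if_neg (not_le.2 h0), if_neg (not_le.2 h1), if_neg h2]
      simp
    beta_reduce
    rw [h3, one_mul]
    exact hround x 1 le_rfl

/-- Failure of approximability at the critical exponent. -/
theorem exists_far_point {d : ℕ} (hd : 0 < d) (a : ℝ) :
    ∃ ε : ℝ, 0 < ε ∧ ∀ Q : ℕ, 1 ≤ Q → ∃ x : Fin d → ℝ, ∀ q : ℕ, 1 ≤ q → q ≤ Q →
      ∀ p : Fin d → ℤ, ε * Psi a (fd d a) q Q ≤ ‖x - fun i => (p i : ℝ) / (q : ℝ)‖ := by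
  by_cases h0 : a ≤ 0
  · refine ⟨1 / 2, by norm_num, fun Q hQ => ⟨fun _ => 1 / (2 * Q), fun q hq hqQ p => ?_⟩⟩
    have hq0 : (0 : ℝ) < q := by exact_mod_cast hq
    have hQ0 : (0 : ℝ) < Q := by exact_mod_cast hQ
    have hqQ' : (q : ℝ) ≤ Q := by exact_mod_cast hqQ
    refine le_trans ?_ (norm_le_pi_norm _ ⟨0, hd⟩)
    rw [Pi.sub_apply, Real.norm_eq_abs]
    refine le_trans ?_ (half_inv_le_abs_sub_div' hq hqQ' (p ⟨0, hd⟩))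
    rw [Psi, fd, if_pos h0, abs_of_nonpos h0]
    calc 1 / 2 * ((q : ℝ) ^ (-a) * (Q : ℝ) ^ (-(1 + -a)))
        ≤ 1 / 2 * ((Q : ℝ) ^ (-a) * (Q : ℝ) ^ (-(1 + -a))) := by
          gcongr
          linarith
      _ = 1 / 2 * (Q : ℝ) ^ (-1 : ℝ) := by
          rw [← Real.rpow_add hQ0]
          congr 2
          ring
      _ = 1 / (2 * Q) := by
          rw [Real.rpow_neg_one]
          field_simp
  push Not at h0
  by_cases h1 : a ≤ 1
  · refine ⟨1 / 2, by norm_num, fun Q hQ => ?_⟩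
    obtain ⟨e, rfl⟩ := Nat.exists_eq_add_one.2 hd
    obtain ⟨x, hx⟩ := exists_far_from_fractions h0 h1 e (T := Q) (by exact_mod_cast hQ)
    refine ⟨x, fun q hq hqQ p => ?_⟩
    rw [Psi, fd, if_neg (not_le.2 h0), if_pos h1]
    exact hx q hq (by exact_mod_cast hqQ) p
  push Not at h1
  obtain ⟨c, x, hc, hx⟩ := exists_badly_approximable hd
  refine ⟨c, hc, fun Q hQ => ⟨x, fun q hq hqQ p => le_trans ?_ (hx q hq p)⟩⟩
  have hq1 : (1 : ℝ) ≤ q := by exact_mod_cast hq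
  have hq0 : (0 : ℝ) < q := by linarith
  have hqQ' : (q : ℝ) ≤ Q := by exact_mod_cast hqQ
  refine mul_le_mul_of_nonneg_left ?_ hc.le
  by_cases h2 : a ≤ 1 + 1 / (d : ℝ)
  · rw [Psi, fd, if_neg (not_le.2 h0), if_neg (not_le.2 h1), if_pos h2]
    calc (q : ℝ) ^ (-a) * (Q : ℝ) ^ (-(1 + 1 / (d : ℝ) - a))
        ≤ (q : ℝ) ^ (-a) * (q : ℝ) ^ (-(1 + 1 / (d : ℝ) - a)) :=
          mul_le_mul_of_nonneg_left
            (Real.rpow_le_rpow_of_nonpos hq0 hqQ' (by linarith)) (by positivity)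
      _ = (q : ℝ) ^ (-(1 + 1 / (d : ℝ))) := by
          rw [← Real.rpow_add hq0]
          congr 1
          ring
  · rw [Psi, fd, if_neg (not_le.2 h0), if_neg (not_le.2 h1), if_neg h2, neg_zero, Real.rpow_zero,
      mul_one]
    exact Real.rpow_le_rpow_of_exponent_le hq1 (by linarith [not_le.1 h2])

/-- A larger power of `1 / Q` eventually beats any constant. -/
theorem exists_mul_Psi_le {A A' : ℝ} (hA : A' < A) (a κ : ℝ) {ε : ℝ} (hε : 0 < ε) :
    ∃ Q₁ : ℕ, ∀ q Q : ℕ, Q₁ ≤ Q → 1 ≤ q → q ≤ Q → κ * Psi a A q Q ≤ ε * Psi a A' q Q := by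
  have htend := (tendsto_rpow_atTop (sub_pos.2 hA)).comp (tendsto_natCast_atTop_atTop (R := ℝ))
  obtain ⟨Q₁, hQ₁⟩ := Filter.eventually_atTop.1 (htend.eventually_ge_atTop (κ / ε))
  refine ⟨Q₁, fun q Q hQ hq hqQ => ?_⟩
  have hq0 : (0 : ℝ) < q := by exact_mod_cast hq
  have hQ0 : (0 : ℝ) < Q := by exact_mod_cast hq.trans hqQ
  have h1 : κ / ε ≤ (Q : ℝ) ^ (A - A') := hQ₁ Q hQ
  have h2 : (Q : ℝ) ^ (-A') = (Q : ℝ) ^ (A - A') * (Q : ℝ) ^ (-A) := by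
    rw [← Real.rpow_add hQ0]
    congr 1
    ring
  rw [div_le_iff₀ hε] at h1
  rw [Psi, Psi, h2]
  have h3 : 0 ≤ (q : ℝ) ^ (-a) * (Q : ℝ) ^ (-A) := by positivity
  nlinarith [mul_le_mul_of_nonneg_right h1 h3]

end Approximation

/-! ### Assembly -/

theorem theorem1 (d : ℕ) (hd : 0 < d) (a A : ℝ) :
    (A < DirichletVariations.fd d a →
      ∀ ε : ℝ, 0 < ε →
        DirichletVariations.UniformlyApproximable
          (fun q Q => ε * DirichletVariations.Psi a A q Q) (Set.univ : Set (Fin d → ℝ))) ∧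
    (DirichletVariations.fd d a < A →
      ∀ κ : ℝ, 0 < κ →
        ¬ DirichletVariations.UniformlyApproximable
          (fun q Q => κ * DirichletVariations.Psi a A q Q) (Set.univ : Set (Fin d → ℝ))) ∧
    (A = DirichletVariations.fd d a →
      ∃ ε κ : ℝ, 0 < ε ∧ ε ≤ κ ∧
        DirichletVariations.UniformlyApproximable
          (fun q Q => κ * DirichletVariations.Psi a A q Q) (Set.univ : Set (Fin d → ℝ)) ∧
        ¬ DirichletVariations.UniformlyApproximable
          (fun q Q => ε * DirichletVariations.Psi a A q Q) (Set.univ : Set (Fin d → ℝ))) := by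
  obtain ⟨κ₀, hκ₀, hupper⟩ := exists_uniformlyApproximable hd a
  obtain ⟨ε₀, hε₀, hfar⟩ := exists_far_point hd a
  have hlower : ¬ UniformlyApproximable (fun q Q => ε₀ * Psi a (fd d a) q Q)
      (Set.univ : Set (Fin d → ℝ)) := by
    -- The far point chosen for the claimed threshold `Q` itself already refutes it.
    rintro ⟨Q, hQ, h⟩
    obtain ⟨x, hx⟩ := hfar Q hQ
    obtain ⟨p, q, hq, hqQ, hlt⟩ := h x (Set.mem_univ x) Q le_rfl
    exact absurd hlt (not_lt.2 (hx q hq hqQ p))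
  refine ⟨fun hA ε hε => ?_, fun hA κ hκ h => ?_, ?_⟩
  · obtain ⟨Q₁, hQ₁⟩ := exists_mul_Psi_le hA a κ₀ hε
    exact UniformlyApproximable.mono hupper Q₁ hQ₁
  · obtain ⟨Q₁, hQ₁⟩ := exists_mul_Psi_le hA a κ hε₀
    exact hlower (UniformlyApproximable.mono h Q₁ hQ₁)
  · rintro rfl
    refine ⟨ε₀, max ε₀ κ₀, hε₀, le_max_left _ _, ?_, hlower⟩
    refine UniformlyApproximable.mono hupper 0 fun q Q _ _ _ => ?_
    refine mul_le_mul_of_nonneg_right (le_max_right _ _) ?_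
    rw [Psi]
    positivity
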